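/- Let $p(z)=a_0z^n+a_1z^{n-1}+\cdots+a_n$ be a real polynomial of degree $n$ with $a_0>0$ and $a_n\neq 0$, and put $a_k=0$ for $k<0$ and $k>n$. Let $\mathcal H_n(p)=(a_{2j-i})_{i,j=1}^{n}$ be its finite Hurwitz matrix, and let $\Delta_j(p)=\det(a_{2k-i})_{i,k=1}^{j}$ for $j\ge 0$ be its Hurwitz determinants (for $j\le n$ these are the leading principal minors of $\mathcal H_n(p)$; $\Delta_0(p)=1$ and $\Delta_{n+1}(p)=0$). Suppose that $\mathcal H_n(p)$ is totally nonnegative, i.e. all its minors are nonnegative, and let $0\le m\le n$ be such that $\Delta_m(p)\neq 0$ and $\Delta_{m+1}(p)=0$. Then: 1. $n-m$ is even, and $\mathcal H_n(p)$ has, counted with algebraic multiplicity, exactly $\frac{n+m}{2}$ positive eigenvalues and $\frac{n-m}{2}$ zero eigenvalues. 2. The kernel of $\mathcal H_n(p)$ has dimension $\frac{n-m}{2}$, so that the algebraic and geometric multiplicities of the eigenvalue zero coincide. 3. Every positive eigenvalue of $\mathcal H_n(p)$ has a one-dimensional eigenspace, that is, a single Jordan block. 4. Every positive eigenvalue of $\mathcal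 H_n(p)$ has algebraic multiplicity $1$, with the possible exception of the eigenvalue $p(0)=a_n$, whose algebraic multiplicity may be $2$ (and is never larger). -/

import Mathlib

open Polynomial

/-- The coefficient `a_k` of a real polynomial written as
`p(z) = a_0 z^n + a_1 z^(n-1) + ⋯ + a_n` with `n = deg p`, where `a_k = 0` for `k > n`. -/
noncomputable def descCoeff (p : ℝ[X]) (k : ℕ) : ℝ :=
  if k ≤ p.natDegree then p.coeff (p.natDegree - k) else 0

/-- The `k × k` Hurwitz array of `p`: in one-based indices the `(i, j)` entry is `a_(2j - i)`,
with `a_l = 0` for `l < 0` and for `l > deg p`. The indices of `Fin k` are zero-based, so that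
`2(j+1) - (i+1) = 2j + 1 - i`. -/
noncomputable def hurwitzArray (p : ℝ[X]) (k : ℕ) : Matrix (Fin k) (Fin k) ℝ :=
  Matrix.of fun i j =>
    if (i : ℕ) ≤ 2 * (j : ℕ) + 1 then descCoeff p (2 * (j : ℕ) + 1 - (i : ℕ)) else 0

/-- The finite Hurwitz matrix `H_n(p)` of `p`, where `n = deg p`. -/
noncomputable def finiteHurwitzMatrix (p : ℝ[X]) :
    Matrix (Fin p.natDegree) (Fin p.natDegree) ℝ :=
  hurwitzArray p p.natDegree

/-- The Hurwitz determinant `Δ_j(p)`. For `j ≤ deg p` it is the leading principal minor of order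
`j` of the finite Hurwitz matrix; `Δ_0(p) = 1`, and the convention `a_l = 0` for `l > deg p` also
gives it a meaning for `j > deg p`. -/
noncomputable def hurwitzDet (p : ℝ[X]) (j : ℕ) : ℝ :=
  (hurwitzArray p j).det

/-- A real square matrix is totally nonnegative if all its minors, formed with any rows
`r 0 < r 1 < ⋯` and any columns `c 0 < c 1 < ⋯`, are nonnegative. -/
def IsTotallyNonnegative {n : ℕ} (A : Matrix (Fin n) (Fin n) ℝ) : Prop :=
  ∀ (k : ℕ) (r c : Fin k → Fin n), StrictMono r → StrictMono c → 0 ≤ (A.submatrix r c).det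

/-! Let `f = p.reverse`, so that the coefficient of `X^k` in `f` is `a_k`. Dividing `f` by its gcd
with `f(-X)`, which is even, gives `f = q · D(X²)` with `q` coprime to `q(-X)`. With `l = deg D` one
has `n = deg q + 2l`. Every Hurwitz array of `f` is the array of `q` times the upper triangular
Toeplitz matrix of `D`, which is invertible because `D(0) ≠ 0` (`hurwitzOf_mul_expand`).

The zero eigenvalue. A vanishing combination of rows of the array of `q` is a polynomial `g` with `g
* q` even. Coprimality then gives `q(-X) ∣ g` with even quotient, so `deg g - deg q` is even and
nonnegative. Choosing rows that exclude these degrees yields a nonzero minor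
(`det_hurwitzOf_submatrix_ne_zero`). With no extra rows it shows that the Hurwitz determinant of
order `deg q` is nonzero. Those of higher order vanish, and total nonnegativity keeps the lower ones
nonzero, so `m = deg q`. In general the minor shows that the first `m + l` columns of the array of
`q` are independent; the others are zero, so the kernel of the Hurwitz matrix has dimension `l`. For
the algebraic multiplicity it suffices to find one nonzero principal minor of order `m + l`, since
the principal minors are nonnegative and cannot cancel in the characteristic polynomial. The indices
`hurwitzIndex` provide it; independence of these columns is where total nonnegativity enters
(`exists_mulVec_eq_col`).

The positive eigenvalues. If `a_1 > 0`, all coefficients are positive. The last column is zero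
except for its corner entry `a_n`, so the characteristic polynomial is `X - a_n` times that of a
totally nonnegative matrix with positive sub- and superdiagonal. For such matrices the
Desnanot–Jacobi identity and an interlacing induction make the spectrum real and its positive part
simple (`charpoly_splits_and_derivative_mul_pos`). This leaves `a_n` as the only possible double
eigenvalue. A positive corner minor of `A - x` makes the eigenspaces one-dimensional. If `a_1 = 0`,
all odd coefficients vanish and the problem reduces to the Hurwitz array of the even coefficients.
-/

namespace Matrix

/-! ### Determinantal identities -/

section Minors

variable {R : Type*} [CommRing R]

/-- Expansion of a determinant in a single entry. -/
theorem det_eq_add_of_entry {k : ℕ} (M N : Matrix (Fin (k + 1)) (Fin (k + 1)) R)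
    (i j : Fin (k + 1)) (c : R) (hij : M i j = N i j + c)
    (h : ∀ a b, (a ≠ i ∨ b ≠ j) → M a b = N a b) :
    M.det = N.det + c * ((-1) ^ ((i : ℕ) + j) * (N.submatrix i.succAbove j.succAbove).det) := by
  rw [det_succ_row M i, det_succ_row N i, ← Finset.add_sum_erase _ _ (Finset.mem_univ j),
    ← Finset.add_sum_erase Finset.univ (fun b : Fin (k + 1) => (-1) ^ ((i : ℕ) + b) * N i b *
      (N.submatrix i.succAbove b.succAbove).det) (Finset.mem_univ j)]
  have h1 : ∀ b, M.submatrix i.succAbove (Fin.succAbove b) =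
      N.submatrix i.succAbove (Fin.succAbove b) := fun b => by
    ext a b'
    exact h _ _ (Or.inl (Fin.succAbove_ne i a))
  have h2 : ∑ x ∈ Finset.univ.erase j, (-1) ^ ((i : ℕ) + (x : ℕ)) * M i x *
        (M.submatrix i.succAbove x.succAbove).det =
      ∑ x ∈ Finset.univ.erase j, (-1) ^ ((i : ℕ) + (x : ℕ)) * N i x *
        (N.submatrix i.succAbove x.succAbove).det :=
    Finset.sum_congr rfl fun b hb => by
      rw [h1, h i b (Or.inr (Finset.ne_of_mem_erase hb))]
  rw [h2, h1, hij]
  ring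

/-- The Schur complement of the upper left entry. -/
def schurComplZero {K : Type*} [Field K] {m n : ℕ} (A : Matrix (Fin (m + 1)) (Fin (n + 1)) K) :
    Matrix (Fin m) (Fin n) K :=
  of fun i j => A i.succ j.succ - A i.succ 0 * A 0 j.succ / A 0 0

theorem det_eq_mul_det_schurComplZero {K : Type*} [Field K] {n : ℕ}
    (A : Matrix (Fin (n + 1)) (Fin (n + 1)) K) (h : A 0 0 ≠ 0) :
    A.det = A 0 0 * A.schurComplZero.det := by
  let B : Matrix (Fin (n + 1)) (Fin (n + 1)) K :=
    of fun i j => if i = 0 then A 0 j else A i j - A i 0 * A 0 j / A 0 0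
  have h1 : A.det = B.det := by
    refine det_eq_of_forall_row_eq_smul_add_const (fun i => if i = 0 then 0 else A i 0 / A 0 0) 0
      (by simp) fun i j => ?_
    by_cases hi : i = 0
    · simp [B, hi]
    · simp only [B, of_apply, hi, if_false, if_true]
      ring
  rw [h1, det_succ_column_zero, Finset.sum_eq_single 0]
  · have h2 : B.submatrix (Fin.succAbove 0) Fin.succ = A.schurComplZero := by
      ext i j
      simp [B, schurComplZero, Fin.succ_ne_zero]
    have h3 : B 0 0 = A 0 0 := by simp [B]
    rw [h2, h3, Fin.val_zero, pow_zero, one_mul]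
  · intro b _ hb
    have : B b 0 = 0 := by
      simp [B, hb, h]
    simp [this]
  · simp

/-- The **Desnanot–Jacobi identity** for a matrix with nonzero determinant. -/
theorem det_mul_det_interior [IsDomain R] {n : ℕ} (M : Matrix (Fin (n + 2)) (Fin (n + 2)) R)
    (h : M.det ≠ 0) :
    M.det * (M.submatrix (fun i : Fin n => i.castSucc.succ) fun i : Fin n => i.castSucc.succ).det =
      (M.submatrix Fin.succ Fin.succ).det * (M.submatrix Fin.castSucc Fin.castSucc).det -
      (M.submatrix Fin.succ Fin.castSucc).det * (M.submatrix Fin.castSucc Fin.succ).det := by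
  let f : Fin 2 ⊕ Fin n → Fin (n + 2) := Sum.elim ![0, Fin.last _] fun i => i.castSucc.succ
  have hf : Function.Bijective f := by
    rw [Fintype.bijective_iff_injective_and_card]
    constructor
    · rintro (a | a) (b | b) hab
      · fin_cases a <;> fin_cases b <;> simp_all [f, Fin.ext_iff]
      · have := b.2
        fin_cases a <;> simp [f, Fin.ext_iff] at hab <;> omega
      · have := a.2
        fin_cases b <;> simp [f, Fin.ext_iff] at hab <;> omega
      · simpa [f, Fin.ext_iff] using hab
    · simp [add_comm]
  let e : Fin 2 ⊕ Fin n ≃ Fin (n + 2) := Equiv.ofBijective f hf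
  let M' := M.submatrix e e
  let J := M.adjugate.submatrix e e
  have hMJ : M' * J = M.det • (1 : Matrix _ _ R) := by
    simp only [M', J]
    rw [submatrix_mul_equiv, mul_adjugate, submatrix_smul, Pi.smul_apply, Pi.smul_apply,
      submatrix_one_equiv]
  have hdet : M'.det = M.det := det_submatrix_equiv_self e M
  -- With the first and last indices moved to the front, keep only the two corresponding columns of
  -- the adjugate. Determinants in `key` then give `det M * det J₁₁ = (det M)² * det M'₂₂`, where
  -- `J₁₁` consists of four minors of `M`.
  let B := fromBlocks J.toBlocks₁₁ 0 J.toBlocks₂₁ (1 : Matrix (Fin n) (Fin n) R)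
  have key : M' * B = fromBlocks (M.det • (1 : Matrix (Fin 2) (Fin 2) R)) M'.toBlocks₁₂ 0
      M'.toBlocks₂₂ := by
    rw [← fromBlocks_toBlocks M', ← fromBlocks_toBlocks J, fromBlocks_multiply,
      ← fromBlocks_one, fromBlocks_smul, fromBlocks_inj] at hMJ
    conv_lhs => rw [← fromBlocks_toBlocks M']
    rw [fromBlocks_multiply, hMJ.1, hMJ.2.2.1]
    simp
  have h3 := congrArg det key
  rw [det_mul, hdet, det_fromBlocks_zero₁₂, det_fromBlocks_zero₂₁, det_one, mul_one,
    det_smul, det_one, mul_one, Fintype.card_fin, pow_two, mul_assoc] at h3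
  have h4 := mul_left_cancel₀ h h3
  have h5 : M'.toBlocks₂₂ = M.submatrix (fun i : Fin n => i.castSucc.succ)
      fun i : Fin n => i.castSucc.succ := rfl
  rw [← h5, ← h4, det_fin_two]
  have e0 : e (Sum.inl 0) = 0 := rfl
  have e1 : e (Sum.inl 1) = Fin.last _ := rfl
  simp only [J, toBlocks₁₁, of_apply, submatrix_apply, e0, e1,
    adjugate_fin_succ_eq_det_submatrix, Fin.val_zero, Fin.val_last, Fin.succAbove_last,
    Fin.succAbove_zero]
  have hs : ((-1 : R) ^ (n + 1)) * (-1) ^ (n + 1) = 1 := by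
    rw [← mul_pow]; simp
  simp only [add_zero, zero_add, pow_zero, one_mul, pow_add _ (n + 1) (n + 1), hs]
  linear_combination (-(M.submatrix Fin.succ Fin.castSucc).det *
    (M.submatrix Fin.castSucc Fin.succ).det) * hs

end Minors

end Matrix

/-! ### Minors of totally nonnegative matrices -/

namespace IsTotallyNonnegative

open Matrix

variable {n : ℕ} {A : Matrix (Fin n) (Fin n) ℝ}

theorem submatrix (hA : IsTotallyNonnegative A) {k : ℕ} {r c : Fin k → Fin n}
    (hr : StrictMono r) (hc : StrictMono c) : IsTotallyNonnegative (A.submatrix r c) :=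
  fun l r' c' hr' hc' => hA l (r ∘ r') (c ∘ c') (hr.comp hr') (hc.comp hc')

theorem transpose (hA : IsTotallyNonnegative A) : IsTotallyNonnegative Aᵀ := fun k r c hr hc => by
  rw [← det_transpose]
  exact hA k c r hc hr

theorem reverse (hA : IsTotallyNonnegative A) :
    IsTotallyNonnegative (A.submatrix Fin.rev Fin.rev) := fun k r c hr hc => by
  rw [← det_submatrix_equiv_self Fin.revPerm]
  exact hA k (Fin.rev ∘ r ∘ Fin.rev) (Fin.rev ∘ c ∘ Fin.rev)
    (fun a b h => Fin.rev_lt_rev.2 (hr (Fin.rev_lt_rev.2 h)))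
    (fun a b h => Fin.rev_lt_rev.2 (hc (Fin.rev_lt_rev.2 h)))

theorem apply_nonneg (hA : IsTotallyNonnegative A) (i j : Fin n) : 0 ≤ A i j := by
  have := hA 1 (fun _ => i) (fun _ => j) (Subsingleton.strictMono _) (Subsingleton.strictMono _)
  simpa using this

theorem mul_le_mul (hA : IsTotallyNonnegative A) {i i' j j' : Fin n} (hi : i < i') (hj : j < j') :
    A i j' * A i' j ≤ A i j * A i' j' := by
  have := hA 2 ![i, i'] ![j, j'] (by simpa [Fin.strictMono_iff_lt_succ] using hi)
    (by simpa [Fin.strictMono_iff_lt_succ] using hj)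
  rw [det_fin_two] at this
  simpa using this

theorem principal_nonneg (hA : IsTotallyNonnegative A) (s : Finset (Fin n)) :
    0 ≤ (A.submatrix (Subtype.val : s → Fin n) (Subtype.val : s → Fin n)).det := by
  rw [← det_submatrix_equiv_self (s.orderIsoOfFin rfl).toEquiv]
  exact hA _ _ _ (s.orderEmbOfFin rfl).strictMono (s.orderEmbOfFin rfl).strictMono

/-- If the corner entry is zero, the 2 × 2 minors through it force every product of an entry of the
first column with one of the first row to vanish, so one of the two lines is zero. -/
theorem apply_zero_zero_ne_zero {A : Matrix (Fin (n + 1)) (Fin (n + 1)) ℝ}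
    (hA : IsTotallyNonnegative A) (h : A.det ≠ 0) : A 0 0 ≠ 0 := by
  intro h0
  have hz : ∀ i j : Fin n, A i.succ 0 * A 0 j.succ = 0 := fun i j => by
    have := hA.mul_le_mul (Fin.succ_pos i) (Fin.succ_pos j)
    rw [h0, zero_mul, mul_comm] at this
    exact le_antisymm this (mul_nonneg (hA.apply_nonneg _ _) (hA.apply_nonneg _ _))
  by_cases hc : ∀ i : Fin n, A i.succ 0 = 0
  · exact h (det_eq_zero_of_column_eq_zero 0 fun i => Fin.cases h0 hc i)
  · push Not at hc
    obtain ⟨i, hi⟩ := hc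
    exact h (det_eq_zero_of_row_eq_zero 0
      fun j => Fin.cases h0 (fun j => (mul_eq_zero.1 (hz i j)).resolve_left hi) j)

/-- A minor of the Schur complement is the minor of `A` with the first row and column adjoined,
divided by the positive pivot. -/
theorem schurComplZero {A : Matrix (Fin (n + 1)) (Fin (n + 1)) ℝ}
    (hA : IsTotallyNonnegative A) (h : A 0 0 ≠ 0) :
    IsTotallyNonnegative A.schurComplZero := fun k r c hr hc => by
  have hpos : 0 < A 0 0 := lt_of_le_of_ne (hA.apply_nonneg _ _) h.symm
  have hcons : ∀ f : Fin k → Fin n, StrictMono f →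
      StrictMono (Fin.cons 0 (Fin.succ ∘ f) : Fin (k + 1) → Fin (n + 1)) := fun f hf => by
    intro a b hab
    induction a using Fin.cases with
    | zero =>
      induction b using Fin.cases with
      | zero => exact absurd hab (lt_irrefl _)
      | succ b => simp
    | succ a =>
      induction b using Fin.cases with
      | zero => exact absurd hab (not_lt_bot)
      | succ b => simpa using hf (Fin.succ_lt_succ_iff.1 hab)
  have := hA _ _ _ (hcons r hr) (hcons c hc)
  rw [det_eq_mul_det_schurComplZero _ (by simpa using h)] at this
  exact nonneg_of_mul_nonneg_right this hpos

/-- Deleting the last row and column of a nonsingular totally nonnegative matrix leaves a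
nonsingular matrix. -/
theorem det_castSucc_ne_zero : ∀ {n : ℕ} {A : Matrix (Fin (n + 1)) (Fin (n + 1)) ℝ},
    IsTotallyNonnegative A → A.det ≠ 0 → (A.submatrix Fin.castSucc Fin.castSucc).det ≠ 0
  | 0, A, _, _ => by simp
  | n + 1, A, hA, h => by
    have h0 := hA.apply_zero_zero_ne_zero h
    have hS : A.schurComplZero.det ≠ 0 := by
      rw [det_eq_mul_det_schurComplZero A h0] at h
      exact right_ne_zero_of_mul h
    -- Taking the Schur complement at the first index commutes with deleting the last index.
    have ih := det_castSucc_ne_zero (hA.schurComplZero h0) hS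
    rw [det_eq_mul_det_schurComplZero _ (by simpa using h0)]
    exact mul_ne_zero (by simpa using h0) ih

/-- Deleting the first row and column of a nonsingular totally nonnegative matrix leaves a
nonsingular matrix. -/
theorem det_succ_ne_zero {A : Matrix (Fin (n + 1)) (Fin (n + 1)) ℝ}
    (hA : IsTotallyNonnegative A) (h : A.det ≠ 0) : (A.submatrix Fin.succ Fin.succ).det ≠ 0 := by
  have h1 : (A.submatrix Fin.rev Fin.rev).det ≠ 0 := by
    have := det_submatrix_equiv_self Fin.revPerm A
    rw [← this] at h
    exact h
  have h2 := hA.reverse.det_castSucc_ne_zero h1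
  rw [← det_submatrix_equiv_self Fin.revPerm] at h2
  convert h2 using 2
  ext i j
  simp [Fin.rev_castSucc]

/-- The leading principal minors of a nonsingular totally nonnegative matrix do not vanish. -/
theorem det_castLE_ne_zero {k : ℕ} (hk : k ≤ n) (hA : IsTotallyNonnegative A) (h : A.det ≠ 0) :
    (A.submatrix (Fin.castLE hk) (Fin.castLE hk)).det ≠ 0 := by
  induction n, hk using Nat.le_induction with
  | base => simpa using h
  | succ n hk ih =>
    exact ih (hA.submatrix (Fin.strictMono_castSucc) (Fin.strictMono_castSucc))
      (hA.det_castSucc_ne_zero h)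

end IsTotallyNonnegative

/-! ### Corner minors of `A - x` and coefficients of the characteristic polynomial -/

namespace IsTotallyNonnegative

open Matrix

variable {n : ℕ}

/-- Deleting the index `s` from the minor formed with all rows but the first and all columns but
the last. -/
theorem det_sub_diagonal_succ_castSucc {k : ℕ} (A : Matrix (Fin (k + 2)) (Fin (k + 2)) ℝ)
    (y : Fin (k + 2) → ℝ) (i : Fin k) :
    ((A - diagonal y).submatrix Fin.succ Fin.castSucc).det =
      ((A - diagonal (Function.update y i.castSucc.succ 0)).submatrix Fin.succ Fin.castSucc).det +
      y i.castSucc.succ * ((A.submatrix i.castSucc.succ.succAbove i.castSucc.succ.succAbove -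
        diagonal (y ∘ i.castSucc.succ.succAbove)).submatrix Fin.succ Fin.castSucc).det := by
  rw [det_eq_add_of_entry _ ((A - diagonal (Function.update y i.castSucc.succ 0)).submatrix
    Fin.succ Fin.castSucc) i.castSucc i.succ (-y i.castSucc.succ)]
  -- The diagonal entry of `A` sits one place above the diagonal of the minor. Its cofactor sign
  -- `-1` cancels the sign of `-y`, so the expansion has nonnegative coefficients in `y`.
  · have hs : (-1 : ℝ) ^ ((i.castSucc : ℕ) + (i.succ : ℕ)) = -1 := by
      rw [Fin.val_castSucc, Fin.val_succ]
      exact Odd.neg_one_pow ⟨i, by ring⟩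
    have hm : ((A - diagonal (Function.update y i.castSucc.succ 0)).submatrix
        Fin.succ Fin.castSucc).submatrix i.castSucc.succAbove i.succ.succAbove =
        (A.submatrix i.castSucc.succ.succAbove i.castSucc.succ.succAbove -
        diagonal (y ∘ i.castSucc.succ.succAbove)).submatrix Fin.succ Fin.castSucc := by
      ext a b
      have e1 : (i.castSucc.succAbove a).succ = i.castSucc.succ.succAbove a.succ := by simp
      have e2 : (i.succ.succAbove b).castSucc = i.castSucc.succ.succAbove b.castSucc := by
        rw [← Fin.castSucc_succ, Fin.castSucc_succAbove_castSucc]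
      simp only [submatrix_apply, Matrix.sub_apply, e1, e2, diagonal_apply, Function.comp_apply]
      rw [Function.update_of_ne (Fin.succAbove_ne _ _)]
      simp only [Fin.succAbove_right_inj]
    rw [hs, hm]
    ring
  · simp [sub_eq_add_neg]
  · intro a b hab
    simp only [submatrix_apply, Matrix.sub_apply, diagonal_apply]
    by_cases h : a.succ = b.castSucc
    · have : a.succ ≠ i.castSucc.succ := by
        rcases hab with hab | hab
        · simpa using hab
        · rw [h, ← Fin.castSucc_succ]
          exact fun h' => hab (Fin.castSucc_injective _ h')
      simp [Function.update_of_ne this]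
    · simp [h]

/-- Expanding in all the `y i` writes the minor as a combination, with nonnegative coefficients, of
corner minors of principal submatrices of `A`. The recursion is on the size and on the set `S` of
interior indices where `y` may be nonzero; the first and last entries of `y` do not occur in the
minor. -/
theorem det_sub_diagonal_succ_castSucc_nonneg : ∀ {n : ℕ}
    {A : Matrix (Fin (n + 1)) (Fin (n + 1)) ℝ}, IsTotallyNonnegative A →
    ∀ {y : Fin (n + 1) → ℝ}, (∀ i, 0 ≤ y i) →
    0 ≤ ((A - diagonal y).submatrix Fin.succ Fin.castSucc).det
  | 0, _, _, _, _ => by simp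
  | k + 1, A, hA, y, hy => by
    suffices H : ∀ (S : Finset (Fin k)) (y : Fin (k + 2) → ℝ), (∀ i, 0 ≤ y i) →
        (∀ i ∉ S, y i.castSucc.succ = 0) →
        0 ≤ ((A - diagonal y).submatrix Fin.succ Fin.castSucc).det from
      H Finset.univ y hy (by simp)
    intro S
    induction S using Finset.induction with
    | empty =>
      intro y _ h0
      have : (A - diagonal y).submatrix Fin.succ Fin.castSucc =
          A.submatrix Fin.succ Fin.castSucc := by
        ext a b
        simp only [submatrix_apply, Matrix.sub_apply, sub_eq_self, diagonal_apply]
        split_ifs with h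
        · have ha : (a : ℕ) < k := by
            have := b.2
            have := congrArg Fin.val h
            simp only [Fin.val_succ, Fin.val_castSucc] at this
            omega
          exact h0 ⟨a, ha⟩ (by simp)
        · rfl
      rw [this]
      exact hA _ _ _ (Fin.strictMono_succ) (Fin.strictMono_castSucc)
    | insert i S _ ih =>
      intro y hy h0
      rw [det_sub_diagonal_succ_castSucc A y i]
      refine add_nonneg (ih _ (fun j => ?_) fun j hj => ?_) (mul_nonneg (hy _)
        (det_sub_diagonal_succ_castSucc_nonneg (hA.submatrix (Fin.strictMono_succAbove _)
          (Fin.strictMono_succAbove _)) fun j => hy _))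
      · by_cases h : j = i.castSucc.succ
        · simp [h]
        · simpa [h] using hy j
      · by_cases h : j = i
        · simp [h]
        · rw [Function.update_of_ne (by simpa using h)]
          exact h0 j (by simp [h, hj])

/-- For a totally nonnegative matrix with positive subdiagonal and `x > 0`, the minor of `A - x`
formed with all rows but the first and all columns but the last is positive. -/
theorem det_sub_scalar_succ_castSucc_pos : ∀ {n : ℕ}
    {A : Matrix (Fin (n + 1)) (Fin (n + 1)) ℝ}, IsTotallyNonnegative A →
    (∀ i : Fin n, 0 < A i.succ i.castSucc) → ∀ {x : ℝ}, 0 < x →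
    0 < ((A - diagonal fun _ => x).submatrix Fin.succ Fin.castSucc).det
  | 0, _, _, _, _, _ => by simp
  | k + 1, A, hA, hsub, x, hx => by
    -- A nonzero entry two below the diagonal becomes a subdiagonal entry once the index between is
    -- deleted, so the smaller matrix still has positive subdiagonal. If there is no such entry, the
    -- minor is triangular.
    by_cases hex : ∃ i : Fin k, A i.succ.succ i.castSucc.castSucc ≠ 0
    · obtain ⟨i, hi⟩ := hex
      rw [det_sub_diagonal_succ_castSucc A _ i]
      refine add_pos_of_nonneg_of_pos (hA.det_sub_diagonal_succ_castSucc_nonneg fun j => ?_)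
        (mul_pos hx (det_sub_scalar_succ_castSucc_pos (hA.submatrix (Fin.strictMono_succAbove _)
          (Fin.strictMono_succAbove _)) (fun j => ?_) hx))
      · by_cases h : j = i.castSucc.succ
        · simp [h]
        · simpa [h] using hx.le
      · have e1 : i.castSucc.succ.succAbove j.succ = (i.castSucc.succAbove j).succ := by simp
        have e2 : i.castSucc.succ.succAbove j.castSucc = (i.succ.succAbove j).castSucc := by
          rw [← Fin.castSucc_succ, Fin.castSucc_succAbove_castSucc]
        rw [submatrix_apply, e1, e2]
        rcases lt_trichotomy j i with h | h | h
        · rw [Fin.succAbove_of_castSucc_lt _ _ (by simpa using h),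
            Fin.succAbove_of_castSucc_lt _ _ (Fin.castSucc_lt_succ_iff.2 h.le)]
          exact hsub _
        · subst h
          rw [Fin.succAbove_of_castSucc_lt j.succ _ (Fin.castSucc_lt_succ_iff.2 le_rfl),
            Fin.succAbove_of_le_castSucc _ _ le_rfl]
          exact lt_of_le_of_ne (hA.apply_nonneg _ _) hi.symm
        · rw [Fin.succAbove_of_le_castSucc _ _ (by simpa using h.le),
            Fin.succAbove_of_le_castSucc _ _ (by simpa [Fin.le_iff_val_le_val] using h)]
          exact hsub _
    · push Not at hex
      have htri : ((A - diagonal fun _ => x).submatrix Fin.succ Fin.castSucc).IsUpperTriangular := by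
        intro a b hab
        simp only [id] at hab
        have hne : a.succ ≠ b.castSucc := by
          intro h
          have := congrArg Fin.val h
          simp only [Fin.val_succ, Fin.val_castSucc] at this
          have := Fin.lt_def.1 hab
          omega
        simp only [submatrix_apply, Matrix.sub_apply, diagonal_apply, hne, if_false, sub_zero]
        obtain ⟨i, rfl⟩ : ∃ i : Fin k, a = i.succ :=
          ⟨a.pred (Fin.ne_zero_of_lt hab), by simp⟩
        rcases (Fin.le_castSucc_iff.2 hab).eq_or_lt with h | h
        · rw [h]; exact hex i
        -- A zero second subdiagonal and a positive first one force all entries further below to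
        -- vanish, by a 2 × 2 minor.
        · have h1 := hA.mul_le_mul (i := i.castSucc.succ) (i' := i.succ.succ) (j := b.castSucc)
            (j' := i.castSucc.castSucc) (by simp) (by simpa using h)
          rw [hex, mul_zero] at h1
          have h2 := hsub i.castSucc
          have h3 := hA.apply_nonneg i.succ.succ b.castSucc
          exact le_antisymm (nonpos_of_mul_nonpos_right h1 h2) h3
      rw [det_of_isUpperTriangular htri]
      refine Finset.prod_pos fun i _ => ?_
      simpa [diagonal_apply, (Fin.castSucc_lt_succ (i := i)).ne'] using hsub i

/-- Up to sign the coefficient is the sum of the principal minors of order `k`; all are nonnegative,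
so nothing cancels. -/
theorem charpoly_coeff_ne_zero_iff {A : Matrix (Fin n) (Fin n) ℝ} (hA : IsTotallyNonnegative A)
    {k : ℕ} (hk : k ≤ n) : A.charpoly.coeff (n - k) ≠ 0 ↔
      ∃ s : Finset (Fin n), s.card = k ∧
        (A.submatrix (Subtype.val : s → Fin n) (Subtype.val : s → Fin n)).det ≠ 0 := by
  have h := charpoly_coeff_eq_sum_minors A k (by simpa using hk)
  rw [Fintype.card_fin] at h
  rw [h, mul_ne_zero_iff, Ne, Ne, Finset.sum_eq_zero_iff_of_nonneg
    (fun s _ => hA.principal_nonneg s)]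
  simp

/-- The coefficients alternate weakly in sign, so at `-x` every term has the sign `(-1)^n` or is
zero, and the leading term is nonzero. -/
theorem eval_neg_charpoly_ne_zero {A : Matrix (Fin n) (Fin n) ℝ} (hA : IsTotallyNonnegative A)
    {x : ℝ} (hx : 0 < x) : A.charpoly.eval (-x) ≠ 0 := by
  have hd : A.charpoly.natDegree = n := by simp
  rw [eval_eq_sum_range, hd, ← Finset.sum_range_reflect]
  have h1 : ∀ k ∈ Finset.range (n + 1), A.charpoly.coeff (n + 1 - 1 - k) * (-x) ^ (n + 1 - 1 - k) =
      (-1) ^ n * ((∑ s ∈ Finset.univ.powersetCard k,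
        (A.submatrix (Subtype.val : s → Fin n) (Subtype.val : s → Fin n)).det) * x ^ (n - k)) := by
    intro k hk
    have hk' : k ≤ n := Nat.lt_succ_iff.1 (Finset.mem_range.1 hk)
    have h := charpoly_coeff_eq_sum_minors A k (by simpa using hk')
    rw [Fintype.card_fin] at h
    rw [Nat.add_sub_cancel, h, neg_pow x]
    have : (-1 : ℝ) ^ n = (-1) ^ k * (-1) ^ (n - k) := by rw [← pow_add, Nat.add_sub_cancel' hk']
    rw [this]
    ring
  rw [Finset.sum_congr rfl h1, ← Finset.mul_sum]
  refine mul_ne_zero (by simp) (ne_of_gt ?_)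
  refine Finset.sum_pos' (fun k _ => mul_nonneg (Finset.sum_nonneg fun s _ =>
    hA.principal_nonneg s) (by positivity)) ⟨0, by simp, ?_⟩
  simp
  positivity

/-- The multiplicity of zero is the size minus the largest order of a nonzero principal minor.
Dropping the smallest index of such a minor lowers its order by one, keeps it nonzero, and leaves
only indices other than the first. -/
theorem rootMultiplicity_zero_charpoly_succ_le {A : Matrix (Fin (n + 1)) (Fin (n + 1)) ℝ}
    (hA : IsTotallyNonnegative A) :
    (A.submatrix Fin.succ Fin.succ).charpoly.rootMultiplicity 0 ≤
      A.charpoly.rootMultiplicity 0 := by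
  rw [rootMultiplicity_eq_natTrailingDegree', rootMultiplicity_eq_natTrailingDegree']
  set d := A.charpoly.natTrailingDegree with hd
  have hne : A.charpoly.coeff d ≠ 0 := by
    rw [hd, ← trailingCoeff]
    exact mt trailingCoeff_eq_zero.1 A.charpoly_monic.ne_zero
  have hdn : d ≤ n + 1 := by
    have := natTrailingDegree_le_natDegree A.charpoly
    simpa using this
  by_cases hd' : d = n + 1
  · rw [hd']
    have := natTrailingDegree_le_natDegree (A.submatrix Fin.succ Fin.succ).charpoly
    simp only [charpoly_natDegree_eq_dim, Fintype.card_fin] at this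
    omega
  · obtain ⟨k, hk⟩ : ∃ k, d = n - k ∧ k ≤ n := ⟨n - d, by omega, by omega⟩
    have h1 : d = n + 1 - (k + 1) := by omega
    rw [h1, hA.charpoly_coeff_ne_zero_iff (by omega)] at hne
    obtain ⟨s, hs, hdet⟩ := hne
    rw [← det_submatrix_equiv_self (s.orderIsoOfFin hs).toEquiv] at hdet
    let f := s.orderEmbOfFin hs
    have hdet' : ((A.submatrix f f).submatrix Fin.succ Fin.succ).det ≠ 0 :=
      (hA.submatrix f.strictMono f.strictMono).det_succ_ne_zero hdet
    have hpos : ∀ i : Fin k, f i.succ ≠ 0 := fun i =>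
      Fin.ne_zero_of_lt (f.strictMono (Fin.succ_pos i))
    let g : Fin k → Fin n := fun i => (f i.succ).pred (hpos i)
    have hg : StrictMono g := fun i j hij => Fin.pred_lt_pred_iff.2
      (f.strictMono (Fin.succ_lt_succ_iff.2 hij))
    have hcoeff : (A.submatrix Fin.succ Fin.succ).charpoly.coeff (n - k) ≠ 0 := by
      rw [(hA.submatrix Fin.strictMono_succ Fin.strictMono_succ).charpoly_coeff_ne_zero_iff hk.2]
      refine ⟨Finset.univ.map ⟨g, hg.injective⟩, by simp, ?_⟩
      let e : Fin k ≃ (Finset.univ.map ⟨g, hg.injective⟩ : Finset (Fin n)) :=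
        Equiv.ofBijective (fun i => ⟨g i, by simp⟩) ⟨fun i j hij => hg.injective (by simpa using hij),
          fun ⟨j, hj⟩ => by simpa using hj⟩
      rw [← det_submatrix_equiv_self e]
      convert hdet' using 2
      ext i j
      change A (g i).succ (g j).succ = A (f i.succ) (f j.succ)
      simp [g]
    rw [hk.1]
    exact natTrailingDegree_le_of_ne_zero hcoeff

end IsTotallyNonnegative

/-! ### Interlacing polynomials -/

namespace Polynomial

open Lagrange

/-- Partial fractions of a monic polynomial divided by a nodal polynomial of one degree less. -/
theorem Monic.exists_eq_add_sum_nodal_erase {K : Type*} [Field K] [DecidableEq K] {S : K[X]}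
    (hS : S.Monic) {F : Finset K} (hdeg : S.natDegree = F.card + 1) :
    ∃ c : K, S = (X + C c) * nodal F id +
      ∑ μ ∈ F, C (S.eval μ / (derivative (nodal F id)).eval μ) * nodal (F.erase μ) id := by
  have hN : (nodal F (id : K → K)).Monic := nodal_monic
  have hnd : (nodal F (id : K → K)).natDegree = F.card := natDegree_nodal
  set N : K[X] := nodal F id with hNdef
  have hle : N.natDegree ≤ S.natDegree := by omega
  have hQ : (S /ₘ N).Monic := by
    rw [Monic, leadingCoeff_divByMonic_of_monic hN, hS.leadingCoeff]
    rw [degree_eq_natDegree hN.ne_zero, degree_eq_natDegree hS.ne_zero]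
    exact_mod_cast hle
  have hQ1 : (S /ₘ N).natDegree = 1 := by
    rw [natDegree_divByMonic _ hN]; omega
  refine ⟨(S /ₘ N).coeff 0, ?_⟩
  rw [← hQ.eq_X_add_C hQ1]
  have hT : S %ₘ N = ∑ μ ∈ F, C (S.eval μ / (derivative N).eval μ) * nodal (F.erase μ) id := by
    have h1 : (S %ₘ N).degree < F.card := by
      have := degree_modByMonic_lt S hN
      rwa [degree_nodal] at this
    rw [eq_interpolate (s := F) (v := id) (f := S %ₘ N) (Function.injective_id.injOn) h1,
      interpolate_apply]
    refine Finset.sum_congr rfl fun μ hμ => ?_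
    rw [basis_eq_prod_sub_inv_mul_nodal_div hμ, ← nodal_erase_eq_nodal_div hμ,
      nodalWeight_eq_eval_derivative_nodal hμ, ← mul_assoc, ← C_mul]
    have h2 : (S %ₘ N).eval μ = S.eval μ := by
      conv_rhs => rw [← modByMonic_add_div S N]
      have : N.eval μ = 0 := eval_nodal_at_node (v := id) hμ
      simp [this]
    simp only [id, h2, div_eq_mul_inv]
    rfl
  rw [← hT, mul_comm, add_comm, modByMonic_add_div]

/-- A monic real polynomial which has at the simple nodes `F` signs opposite to those of the
derivative of the nodal polynomial has only real roots, and they are simple and interlace `F`. -/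
theorem Monic.splits_and_derivative_mul_pos {S : ℝ[X]} (hS : S.Monic) {F : Finset ℝ}
    (hdeg : S.natDegree = F.card + 1)
    (h : ∀ μ ∈ F, S.eval μ * (derivative (nodal F id)).eval μ < 0) :
    S.Splits ∧ ∀ x, S.eval x = 0 → 0 < (derivative S).eval x * (nodal F id).eval x := by
  obtain ⟨c, hc⟩ := hS.exists_eq_add_sum_nodal_erase hdeg
  set w : ℝ → ℝ := fun μ => S.eval μ / (derivative (nodal F id)).eval μ with hw
  have hw0 : ∀ μ ∈ F, w μ < 0 := fun μ hμ => by
    have := h μ hμ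
    rw [hw]
    rcases mul_neg_iff.1 this with h' | h'
    · exact div_neg_of_pos_of_neg h'.1 h'.2
    · exact div_neg_of_neg_of_pos h'.1 h'.2
  have hN : ∀ μ ∈ F, nodal F (id : ℝ → ℝ) = (X - C μ) * nodal (F.erase μ) id :=
    fun μ hμ => nodal_eq_mul_nodal_erase hμ
  constructor
  · refine Splits.of_splits_map Complex.ofRealHom (IsAlgClosed.splits _) fun z hz => ?_
    have hz0 : eval₂ Complex.ofRealHom z S = 0 := by
      rw [← eval_map]; exact (mem_roots'.1 hz).2
    by_contra him
    have him' : z.im ≠ 0 := fun h0 => him ⟨z.re, Complex.ext rfl (by simp [h0])⟩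
    have hne : ∀ μ : ℝ, z - μ ≠ 0 := fun μ h0 => him' (by
      have := congrArg Complex.im h0
      simpa using this)
    set Z : ℂ := eval₂ Complex.ofRealHom z (nodal F id) with hZ
    have hZ0 : Z ≠ 0 := by
      rw [hZ, nodal_eq, eval₂_finsetProd]
      refine Finset.prod_ne_zero_iff.2 fun μ _ => ?_
      simpa using hne μ
    have hE : ∀ μ ∈ F, eval₂ Complex.ofRealHom z (nodal (F.erase μ) id) = Z / (z - μ) :=
      fun μ hμ => by
        rw [eq_div_iff (hne μ), hZ, hN μ hμ, eval₂_mul]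
        simp [mul_comm]
    have h1 : Z * (z + c + ∑ μ ∈ F, (w μ : ℂ) / (z - μ)) = 0 := by
      rw [← hz0]
      conv_rhs => rw [hc]
      rw [eval₂_add, eval₂_mul, eval₂_finsetSum, mul_add, Finset.mul_sum]
      congr 1
      · simp [mul_comm, hZ]
      · refine Finset.sum_congr rfl fun μ hμ => ?_
        rw [eval₂_mul, hE μ hμ, eval₂_C]
        change _ = (w μ : ℂ) * _
        ring
    -- All residues `w μ` are negative, so the imaginary part of `S / N` at `z` is `z.im` times a
    -- number at least `1`. Hence `S` has no nonreal root.
    have h2 := congrArg Complex.im ((mul_eq_zero.1 h1).resolve_left hZ0)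
    have h3 : ∀ μ ∈ F, ((w μ : ℂ) / (z - μ)).im = z.im * (-w μ / Complex.normSq (z - μ)) :=
      fun μ _ => by
        rw [Complex.div_im]
        simp
        ring
    rw [Complex.add_im, Complex.add_im, Complex.im_sum, Finset.sum_congr rfl h3,
      ← Finset.mul_sum, Complex.ofReal_im, add_zero, Complex.zero_im] at h2
    have h4 : z.im * (1 + ∑ μ ∈ F, -w μ / Complex.normSq (z - μ)) = 0 := by linarith
    have h5 : 0 ≤ ∑ μ ∈ F, -w μ / Complex.normSq (z - μ) := Finset.sum_nonneg fun μ hμ =>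
      div_nonneg (by linarith [hw0 μ hμ]) (Complex.normSq_nonneg _)
    rcases mul_eq_zero.1 h4 with h6 | h6
    · exact him' h6
    · linarith
  · intro x hx
    have hN0 : (nodal F id).eval x ≠ 0 := by
      intro h0
      rw [eval_nodal, Finset.prod_eq_zero_iff] at h0
      obtain ⟨μ, hμ, h0⟩ := h0
      have hxμ : x = μ := sub_eq_zero.1 h0
      have := h μ hμ
      rw [← hxμ, hx, zero_mul] at this
      exact lt_irrefl _ this
    -- This is the numerator of the derivative of `S / N = X + c + ∑ w μ / (X - μ)`, a function
    -- increasing off its poles.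
    have key : derivative S * nodal F id - S * derivative (nodal F id) =
        nodal F id ^ 2 + ∑ μ ∈ F, C (-w μ) * nodal (F.erase μ) id ^ 2 := by
      have hterm : ∀ μ ∈ F, derivative (C (w μ) * nodal (F.erase μ) id) * nodal F id -
          C (w μ) * nodal (F.erase μ) id * derivative (nodal F id) =
          C (-w μ) * nodal (F.erase μ) id ^ 2 := fun μ hμ => by
        rw [hN μ hμ]
        simp
        ring
      rw [← Finset.sum_congr rfl hterm, Finset.sum_sub_distrib, ← Finset.sum_mul,
        ← Finset.sum_mul, ← derivative_sum]
      conv_lhs => rw [hc]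
      simp only [derivative_add, derivative_mul, derivative_X, derivative_C, add_zero, one_mul]
      ring
    have h1 := congrArg (eval x) key
    rw [eval_sub, eval_mul, eval_mul, hx, zero_mul, sub_zero] at h1
    rw [h1, eval_add, eval_pow, eval_finsetSum]
    refine add_pos_of_pos_of_nonneg (by positivity) (Finset.sum_nonneg fun μ hμ => ?_)
    rw [eval_mul, eval_C, eval_pow]
    exact mul_nonneg (by linarith [hw0 μ hμ]) (sq_nonneg _)

/-- A monic split polynomial with nonnegative roots, the positive ones simple, is a power of `X`
times a nodal polynomial. -/
theorem Monic.exists_eq_X_pow_mul_nodal {P : ℝ[X]} (hP : P.Monic) (hs : P.Splits)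
    (hnn : ∀ x, P.eval x = 0 → 0 ≤ x)
    (hsimple : ∀ x, 0 < x → P.eval x = 0 → (derivative P).eval x ≠ 0) :
    ∃ F : Finset ℝ, (∀ μ ∈ F, 0 < μ ∧ P.eval μ = 0) ∧
      P = X ^ P.rootMultiplicity 0 * nodal F id := by
  refine ⟨P.roots.toFinset.erase 0, fun μ hμ => ?_, ?_⟩
  · rw [Finset.mem_erase, Multiset.mem_toFinset, mem_roots hP.ne_zero] at hμ
    exact ⟨lt_of_le_of_ne (hnn _ hμ.2) hμ.1.symm, hμ.2⟩
  · have h1 : P = ∏ a ∈ P.roots.toFinset, (X - C a) ^ P.rootMultiplicity a := by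
      conv_lhs => rw [hs.eq_prod_roots_of_monic hP]
      rw [Finset.prod_multiset_map_count]
      simp
    have h2 : ∀ a ∈ P.roots.toFinset.erase 0,
        (X - C a) ^ P.rootMultiplicity a = X - C (id a) := fun a ha => by
      rw [Finset.mem_erase, Multiset.mem_toFinset, mem_roots hP.ne_zero] at ha
      have h3 := hsimple a (lt_of_le_of_ne (hnn _ ha.2) ha.1.symm) ha.2
      have h4 : 0 < P.rootMultiplicity a := (rootMultiplicity_pos hP.ne_zero).2 ha.2
      have h5 : ¬ 1 < P.rootMultiplicity a := fun h => h3
        ((one_lt_rootMultiplicity_iff_isRoot hP.ne_zero).1 h).2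
      rw [show P.rootMultiplicity a = 1 by omega, pow_one, id]
    rw [nodal_eq, ← Finset.prod_congr rfl h2]
    by_cases h0 : (0 : ℝ) ∈ P.roots.toFinset
    · conv_lhs => rw [h1, ← Finset.mul_prod_erase _ _ h0]
      simp
    · have h6 : P.rootMultiplicity 0 = 0 := rootMultiplicity_eq_zero fun h => h0 (by
        rw [Multiset.mem_toFinset, mem_roots hP.ne_zero]; exact h)
      rw [h6, pow_zero, one_mul, Finset.erase_eq_of_notMem h0]
      exact h1

end Polynomial

/-! ### Simplicity of the positive eigenvalues -/

namespace IsTotallyNonnegative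

open Matrix Lagrange

variable {n : ℕ}

theorem _root_.mul_pos_of_mul_pos_of_mul_pos {a b c : ℝ} (h : 0 < a * b) (h' : 0 < b * c) :
    0 < a * c := by
  have h1 : 0 < (a * c) * b ^ 2 := by linarith [mul_pos h h']
  exact pos_of_mul_pos_left h1 (sq_nonneg b)

theorem nonneg_of_eval_charpoly_eq_zero {A : Matrix (Fin n) (Fin n) ℝ}
    (hA : IsTotallyNonnegative A) {x : ℝ} (hx : A.charpoly.eval x = 0) : 0 ≤ x := by
  by_contra h
  have := hA.eval_neg_charpoly_ne_zero (x := -x) (by linarith)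
  rw [neg_neg] at this
  exact this hx

theorem charmatrix_submatrix_eval {m k : ℕ} (A : Matrix (Fin m) (Fin m) ℝ) (r c : Fin k → Fin m)
    (x : ℝ) : (A.charmatrix.submatrix r c).det.eval x =
      (-1) ^ k * ((A - diagonal fun _ => x).submatrix r c).det := by
  have h : (A.charmatrix.submatrix r c).map (eval x) =
      -((A - diagonal fun _ => x).submatrix r c) := by
    ext i j
    by_cases hij : r i = c j <;> simp [hij]
  have h2 := (evalRingHom x).map_det (A.charmatrix.submatrix r c)
  simp only [coe_evalRingHom, RingHom.mapMatrix_apply] at h2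
  rw [h2, h, det_neg, Fintype.card_fin]

/-- The Desnanot–Jacobi identity for characteristic polynomials, as an inequality. -/
theorem exists_pos_charpoly_mul_eq {A : Matrix (Fin (n + 2)) (Fin (n + 2)) ℝ}
    (hA : IsTotallyNonnegative A) (hsub : ∀ i : Fin (n + 1), 0 < A i.succ i.castSucc)
    (hsuper : ∀ i : Fin (n + 1), 0 < A i.castSucc i.succ) {x : ℝ} (hx : 0 < x) :
    ∃ N : ℝ, 0 < N ∧ A.charpoly.eval x *
      (A.submatrix (fun i : Fin n => i.castSucc.succ) fun i => i.castSucc.succ).charpoly.eval x =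
      (A.submatrix Fin.succ Fin.succ).charpoly.eval x *
      (A.submatrix Fin.castSucc Fin.castSucc).charpoly.eval x - N := by
  have key := congrArg (eval x) (det_mul_det_interior A.charmatrix
    (by exact A.charpoly_monic.ne_zero))
  have hcs : ∀ {k : ℕ} (f : Fin k → Fin (n + 2)), Function.Injective f →
      A.charmatrix.submatrix f f = (A.submatrix f f).charmatrix := fun f hf => by
    ext1 i j
    by_cases hij : i = j
    · simp [hij]
    · simp [charmatrix_apply_ne, hij, hf.ne hij]
  rw [hcs _ (Fin.succ_injective _), hcs _ (Fin.castSucc_injective _),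
    hcs (fun i : Fin n => i.castSucc.succ)
      ((Fin.succ_injective _).comp (Fin.castSucc_injective _)), eval_mul, eval_sub, eval_mul,
    eval_mul, charmatrix_submatrix_eval, charmatrix_submatrix_eval] at key
  have p1 := hA.det_sub_scalar_succ_castSucc_pos hsub hx
  have p2 := hA.transpose.det_sub_scalar_succ_castSucc_pos hsuper hx
  have p3 : ((Aᵀ - diagonal fun _ => x).submatrix Fin.succ Fin.castSucc).det =
      ((A - diagonal fun _ => x).submatrix Fin.castSucc Fin.succ).det := by
    rw [← det_transpose, transpose_submatrix, transpose_sub, transpose_transpose,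
      diagonal_transpose]
  rw [p3] at p2
  refine ⟨_, mul_pos p1 p2, key.trans ?_⟩
  have hs : ((-1 : ℝ) ^ (n + 1)) * (-1) ^ (n + 1) = 1 := by
    rw [← mul_pow]; simp
  rw [charpoly, charpoly]
  linear_combination (-((A - diagonal fun _ => x).submatrix Fin.succ Fin.castSucc).det *
    ((A - diagonal fun _ => x).submatrix Fin.castSucc Fin.succ).det) * hs

/-- The eigenvalues of a totally nonnegative matrix with positive sub- and superdiagonal are real,
and the positive ones are simple. -/
theorem charpoly_splits_and_derivative_mul_pos : ∀ {n : ℕ}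
    {A : Matrix (Fin (n + 1)) (Fin (n + 1)) ℝ}, IsTotallyNonnegative A →
    (∀ i : Fin n, 0 < A i.succ i.castSucc) → (∀ i : Fin n, 0 < A i.castSucc i.succ) →
    A.charpoly.Splits ∧ ∀ x, 0 < x → A.charpoly.eval x = 0 →
      0 < (derivative A.charpoly).eval x * (A.submatrix Fin.succ Fin.succ).charpoly.eval x
  | 0, A, _, _, _ => by
    have h : A.charpoly = X - C (A 0 0) := by
      rw [charpoly, ← det_submatrix_equiv_self (Equiv.refl (Fin 1)), det_fin_one]
      simp
    have h' : (A.submatrix Fin.succ Fin.succ).charpoly = 1 := by simp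
    rw [h, h']
    exact ⟨Splits.X_sub_C _, by simp⟩
  | n + 1, A, hA, hsub, hsuper => by
    have hA1 := hA.submatrix (Fin.strictMono_succ) (Fin.strictMono_succ)
    obtain ⟨hsp1, hder1⟩ := charpoly_splits_and_derivative_mul_pos hA1 (fun i => hsub i.succ)
      (fun i => hsuper i.succ)
    set P := A.charpoly with hP
    set P1 := (A.submatrix Fin.succ Fin.succ).charpoly with hP1
    have hm : P.Monic := A.charpoly_monic
    have hm1 : P1.Monic := (A.submatrix Fin.succ Fin.succ).charpoly_monic
    have hneg : ∀ x, 0 < x → P1.eval x = 0 → P.eval x * (derivative P1).eval x < 0 := by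
      intro x hx hx0
      have hd := hder1 x hx hx0
      obtain ⟨N₁, hN₁, e₁⟩ := hA.exists_pos_charpoly_mul_eq hsub hsuper hx
      have hroot : (derivative P1).eval x * (A.submatrix (fun i : Fin n => i.castSucc.succ)
          fun i => i.castSucc.succ).charpoly.eval x > 0 := by
        rcases n with _ | n
        · have h0 : (A.submatrix (fun i : Fin 0 => i.castSucc.succ)
            fun i => i.castSucc.succ).charpoly = 1 := by simp
          have h0' : ((A.submatrix Fin.succ Fin.succ).submatrix Fin.succ Fin.succ).charpoly =
            1 := by simp
          rw [h0]
          rwa [h0'] at hd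
        · obtain ⟨N, hN, e⟩ := hA1.exists_pos_charpoly_mul_eq (fun i => hsub i.succ)
            (fun i => hsuper i.succ) hx
          rw [← hP1, hx0, zero_mul] at e
          have h2 : ((A.submatrix Fin.succ Fin.succ).submatrix Fin.castSucc Fin.castSucc) =
            A.submatrix (fun i : Fin (n + 1) => i.castSucc.succ) fun i => i.castSucc.succ := rfl
          rw [h2] at e
          exact mul_pos_of_mul_pos_of_mul_pos hd (by linarith)
      rw [← hP, ← hP1, hx0, zero_mul] at e₁
      have := mul_pos_of_mul_pos_of_mul_pos (a := -P.eval x) (by linarith)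
        (by rwa [mul_comm])
      linarith
    obtain ⟨F, hF, hF'⟩ := hm1.exists_eq_X_pow_mul_nodal hsp1
      (fun x hx => hA1.nonneg_of_eval_charpoly_eq_zero hx)
      (fun x hx hx0 h0 => by
        have := hder1 x hx hx0
        rw [h0, zero_mul] at this
        exact lt_irrefl _ this)
    set d := P1.rootMultiplicity 0 with hd
    -- The sign information holds only at positive nodes, so the common power of `X` is divided out
    -- before interlacing is applied to `S`.
    have hdvd : X ^ d ∣ P := by
      have h1 := hA.rootMultiplicity_zero_charpoly_succ_le
      have h2 := (le_rootMultiplicity_iff hm.ne_zero).1 h1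
      simpa using h2
    obtain ⟨S, hS⟩ := hdvd
    have hSm : S.Monic := (monic_X_pow d).of_mul_monic_left (hS ▸ hm)
    have hcard : d + F.card = n + 1 := by
      have h1 := congrArg natDegree hF'
      rw [(monic_X_pow d).natDegree_mul nodal_monic, natDegree_X_pow, natDegree_nodal] at h1
      simpa [hP1] using h1.symm
    have hSdeg : S.natDegree = F.card + 1 := by
      have h1 := congrArg natDegree hS
      rw [(monic_X_pow d).natDegree_mul hSm, natDegree_X_pow] at h1
      simp only [hP, charpoly_natDegree_eq_dim, Fintype.card_fin] at h1
      omega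
    obtain ⟨hSs, hSd⟩ := hSm.splits_and_derivative_mul_pos hSdeg fun μ hμ => by
      obtain ⟨hpos, h0⟩ := hF μ hμ
      have h1 := hneg μ hpos h0
      have h2 : (nodal F id).eval μ = 0 := eval_nodal_at_node (v := id) hμ
      rw [hS, hF', derivative_mul, eval_mul, eval_add, eval_mul, eval_mul, h2, mul_zero, zero_add,
        eval_pow, eval_X] at h1
      have h3 : 0 < μ ^ d := by positivity
      have h4 : μ ^ d * eval μ S * (μ ^ d * eval μ (derivative (nodal F id))) =
        (μ ^ d) ^ 2 * (eval μ S * eval μ (derivative (nodal F id))) := by ring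
      rw [h4] at h1
      by_contra h5
      push Not at h5
      have := mul_nonneg (sq_nonneg (μ ^ d)) h5
      linarith
    refine ⟨hS ▸ (Splits.X_pow d).mul hSs, fun x hx hx0 => ?_⟩
    have h3 : 0 < x ^ d := by positivity
    have hSx : S.eval x = 0 := by
      rw [hS, eval_mul, eval_pow, eval_X] at hx0
      exact (mul_eq_zero.1 hx0).resolve_left h3.ne'
    have h4 := mul_pos (mul_pos h3 h3) (hSd x hSx)
    rw [hS, hF', derivative_mul, eval_add, eval_mul, eval_mul, eval_mul, hSx, mul_zero, zero_add,
      eval_pow, eval_X]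
    linarith

end IsTotallyNonnegative

/-! ### Linear relations between columns -/

namespace Matrix

theorem exists_strictMono_det_ne_zero {n k : ℕ} (B : Matrix (Fin n) (Fin k) ℝ)
    (hB : ∀ v, B *ᵥ v = 0 → v = 0) :
    ∃ R : Fin k → Fin n, StrictMono R ∧ (B.submatrix R id).det ≠ 0 := by
  have hrank : B.rank = k := by
    have hinj : Function.Injective B.mulVecLin := by
      rw [← LinearMap.ker_eq_bot, LinearMap.ker_eq_bot']
      exact hB
    rw [Matrix.rank, LinearMap.finrank_range_of_inj hinj, Module.finrank_fin_fun]
  obtain ⟨κ, a, ha, hspan, hli⟩ := exists_linearIndependent' ℝ B.row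
  have : Finite κ := Finite.of_injective a ha
  have : Fintype κ := Fintype.ofFinite κ
  have hcard : Fintype.card κ = k := by
    rw [← finrank_span_eq_card hli, hspan, ← rank_eq_finrank_span_row, hrank]
  let s : Finset (Fin n) := Finset.univ.image a
  have hs : s.card = k := by
    rw [Finset.card_image_of_injective _ ha, Finset.card_univ, hcard]
  refine ⟨s.orderEmbOfFin hs, (s.orderEmbOfFin hs).strictMono, ?_⟩
  have hmem : ∀ i, ∃ b, a b = s.orderEmbOfFin hs i := fun i => by
    simpa only [s, Finset.mem_image, Finset.mem_univ, true_and] using s.orderEmbOfFin_mem hs i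
  choose b hb using hmem
  have hbi : Function.Injective b := fun i j hij =>
    (s.orderEmbOfFin hs).injective (by rw [← hb, ← hb, hij])
  have h1 : LinearIndependent ℝ (B.submatrix (s.orderEmbOfFin hs) id).row := by
    have h2 : (B.submatrix (s.orderEmbOfFin hs) id).row = (B.row ∘ a) ∘ b := by
      funext i
      change B (s.orderEmbOfFin hs i) = B (a (b i))
      rw [hb]
    rw [h2]
    exact hli.comp b hbi
  rw [linearIndependent_rows_iff_isUnit, isUnit_iff_isUnit_det] at h1
  exact h1.ne_zero

/-- The extreme coefficients of a linear relation between `N + 1` columns of height `N`. -/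
theorem last_mul_det_submatrix_succ {N : ℕ} (M : Matrix (Fin N) (Fin (N + 1)) ℝ)
    (α : Fin (N + 1) → ℝ) (h : M *ᵥ α = 0) :
    α (Fin.last N) * (M.submatrix id Fin.succ).det =
      α 0 * (-1) ^ N * (M.submatrix id Fin.castSucc).det := by
  by_cases hα : α = 0
  · simp [hα]
  -- This row is orthogonal to `α`; adjoining it to `M` gives a singular square matrix, whose
  -- expansion along that row has just the two wanted terms.
  let β : Fin (N + 1) → ℝ := Pi.single 0 (α (Fin.last N)) - Pi.single (Fin.last N) (α 0)
  let S : Matrix (Fin (N + 1)) (Fin (N + 1)) ℝ := Matrix.of (Fin.cons β M)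
  have hS : S *ᵥ α = 0 := by
    ext i
    refine Fin.cases ?_ (fun i => ?_) i
    · change β ⬝ᵥ α = 0
      simp [β, sub_dotProduct, mul_comm]
    · exact congrFun h i
  have hdet : S.det = 0 := exists_mulVec_eq_zero_iff.1 ⟨α, hα, hS⟩
  have hsub : ∀ j : Fin (N + 1), S.submatrix Fin.succ j.succAbove = M.submatrix id j.succAbove :=
    fun j => rfl
  have hrow : ∀ j, S 0 j = β j := fun j => rfl
  rw [det_succ_row_zero] at hdet
  simp only [hsub, hrow, β, Pi.sub_apply, mul_sub, sub_mul, Finset.sum_sub_distrib,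
    Pi.single_apply, mul_ite, ite_mul, mul_zero, zero_mul, Finset.sum_ite_eq',
    Finset.mem_univ, if_true, Fin.val_zero, pow_zero, one_mul, Fin.val_last,
    Fin.succAbove_last] at hdet
  rw [Fin.succAbove_zero] at hdet
  linear_combination hdet

end Matrix

namespace IsTotallyNonnegative

open Matrix

variable {n : ℕ} {A : Matrix (Fin n) (Fin n) ℝ}

/-- If the columns `f 0 < ⋯ < f k` of a totally nonnegative matrix are linearly dependent, but
neither the first `k` nor the last `k` of them are, then every column in between lies in their
span. -/
theorem exists_mulVec_eq_col (hA : IsTotallyNonnegative A) {k : ℕ} {f : Fin (k + 1) → Fin n}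
    (hf : StrictMono f) {α : Fin (k + 1) → ℝ} (hα : α ≠ 0) (h0 : A.submatrix id f *ᵥ α = 0)
    (hsucc : ∀ v, A.submatrix id (f ∘ Fin.succ) *ᵥ v = 0 → v = 0)
    (hcast : ∀ v, A.submatrix id (f ∘ Fin.castSucc) *ᵥ v = 0 → v = 0)
    {y : Fin n} (hy0 : f 0 ≤ y) (hy1 : y ≤ f (Fin.last k)) :
    ∃ v, A.submatrix id (f ∘ Fin.succ) *ᵥ v = fun i => A i y := by
  have hα0 : α 0 ≠ 0 := fun h => hα <| by
    have : (fun i : Fin k => α i.succ) = 0 := hsucc _ <| by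
      rw [← h0]
      ext i
      simp [mulVec, dotProduct, Fin.sum_univ_succ, h]
    ext i
    exact Fin.cases h (fun i => congrFun this i) i
  have hα1 : α (Fin.last k) ≠ 0 := fun h => hα <| by
    have : (fun i : Fin k => α i.castSucc) = 0 := hcast _ <| by
      rw [← h0]
      ext i
      simp [mulVec, dotProduct, Fin.sum_univ_castSucc, h]
    ext i
    exact Fin.lastCases h (fun i => congrFun this i) i
  by_cases hyf : ∃ i, f i = y
  · obtain ⟨i, rfl⟩ := hyf
    revert hy0 hy1
    refine Fin.cases (fun _ _ => ?_) (fun i _ _ => ?_) i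
    · refine ⟨fun i => -(α i.succ) / α 0, ?_⟩
      ext i
      have := congrFun h0 i
      simp only [mulVec, dotProduct, Fin.sum_univ_succ, submatrix_apply, id, Pi.zero_apply] at this
      simp only [mulVec, dotProduct, submatrix_apply, id, Function.comp_apply, mul_div_assoc',
        mul_neg, ← Finset.sum_div, Finset.sum_neg_distrib]
      rw [div_eq_iff hα0]
      linarith
    · refine ⟨Pi.single i 1, ?_⟩
      ext j
      simp
  by_contra hno
  have hyf' : ∀ i, f i ≠ y := fun i h => hyf ⟨i, h⟩
  -- Nonnegative minors fix the relative sign of the extreme coefficients of the relation, according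
  -- to the parity of the number of columns.
  have hsign : 0 < α (Fin.last k) * (α 0 * (-1) ^ k) := by
    obtain ⟨R, hR, hdet⟩ := exists_strictMono_det_ne_zero _ hsucc
    have h1 := last_mul_det_submatrix_succ (A.submatrix R f) α (by
      ext i; exact congrFun h0 (R i))
    have p0 : 0 < ((A.submatrix R f).submatrix id Fin.succ).det :=
      lt_of_le_of_ne (hA _ _ _ hR (hf.comp Fin.strictMono_succ)) (Ne.symm hdet)
    have p1 : 0 ≤ ((A.submatrix R f).submatrix id Fin.castSucc).det :=
      hA _ _ _ hR (hf.comp Fin.strictMono_castSucc)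
    have p2 : ((A.submatrix R f).submatrix id Fin.castSucc).det ≠ 0 := fun h => by
      rw [h, mul_zero] at h1
      exact mul_ne_zero hα1 p0.ne' h1
    have p3 := lt_of_le_of_ne p1 p2.symm
    have h3 : 0 < (α (Fin.last k)) ^ 2 * ((A.submatrix R f).submatrix id Fin.succ).det :=
      mul_pos (by positivity) p0
    have h4 : 0 < (α (Fin.last k) * (α 0 * (-1) ^ k)) *
        ((A.submatrix R f).submatrix id Fin.castSucc).det := by
      rw [mul_assoc, ← h1]; linarith
    exact pos_of_mul_pos_left h4 p1
  let s : Finset (Fin n) := insert y (Finset.univ.image f)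
  have hs : s.card = k + 2 := by
    rw [Finset.card_insert_of_notMem (by simpa using hyf'),
      Finset.card_image_of_injective _ hf.injective]
    simp
  let h : Fin (k + 2) ↪o Fin n := s.orderEmbOfFin hs
  have hrange : Set.range h = insert y (Set.range f) := by
    rw [Finset.range_orderEmbOfFin]
    simp [s]
  obtain ⟨t, ht⟩ : y ∈ Set.range h := hrange ▸ Set.mem_insert _ _
  have hhf : h ∘ t.succAbove = f := by
    refine ((h.strictMono.comp (Fin.strictMono_succAbove t)).range_inj hf).1 ?_
    rw [Set.range_comp, Fin.range_succAbove, Set.image_compl_eq_range_sdiff_image h.injective,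
      Set.image_singleton, ht, hrange]
    exact Set.insert_sdiff_self_of_notMem (by simpa using hyf')
  have hhf' : ∀ i, h (t.succAbove i) = f i := congrFun hhf
  have hlt0 : f 0 < y := lt_of_le_of_ne hy0 (hyf' 0)
  have hlt1 : y < f (Fin.last k) := lt_of_le_of_ne hy1 (hyf' _).symm
  have ht0 : t ≠ 0 := fun e => by
    have : h (t.succAbove 0) < h t := by rw [hhf', ht]; exact hlt0
    rw [h.lt_iff_lt, e] at this
    exact absurd this (not_lt_bot)
  have ht1 : t ≠ Fin.last _ := fun e => by
    have : h t < h (t.succAbove (Fin.last k)) := by rw [hhf', ht]; exact hlt1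
    rw [h.lt_iff_lt, e] at this
    exact absurd this (Fin.le_last _).not_gt
  -- Insert column `y` with coefficient zero. The extreme coefficients are unchanged but there is
  -- one more column. Were `y` outside the span, the same sign argument would apply with the
  -- opposite parity, contradicting `hsign`.
  have hα' : ∀ i : Fin n, ∑ j, A i (h j) * t.insertNth (α := fun _ => ℝ) 0 α j = 0 := fun i => by
    rw [Fin.sum_univ_succAbove _ t]
    have := congrFun h0 i
    simpa [mulVec, dotProduct, hhf'] using this
  have hind : ∀ v, A.submatrix id (h ∘ Fin.succ) *ᵥ v = 0 → v = 0 := by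
    intro v hv
    obtain ⟨u, rfl⟩ := Fin.exists_succ_eq.2 ht0
    have hhu : ∀ i : Fin k, h (u.succAbove i).succ = f i.succ := fun i => by
      rw [← hhf', Fin.succ_succAbove_succ]
    have hv' : ∀ i, A i y * v u + ∑ j, A i (f j.succ) * v (u.succAbove j) = 0 := fun i => by
      have := congrFun hv i
      simp only [mulVec, dotProduct, submatrix_apply, id, Function.comp_apply] at this
      rw [Fin.sum_univ_succAbove _ u] at this
      simpa [hhu, ht] using this
    have hvu : v u = 0 := by
      by_contra hne
      refine hno ⟨fun j => -(v (u.succAbove j)) / v u, ?_⟩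
      ext i
      simp only [mulVec, dotProduct, submatrix_apply, id, Function.comp_apply, mul_div_assoc',
        mul_neg, ← Finset.sum_div, Finset.sum_neg_distrib]
      rw [div_eq_iff hne]
      linarith [hv' i]
    have hrest := hsucc (fun j => v (u.succAbove j)) (by
      ext i
      have := hv' i
      rw [hvu, mul_zero, zero_add] at this
      simpa [mulVec, dotProduct] using this)
    ext j
    by_cases hj : j = u
    · rw [hj, hvu]; rfl
    · obtain ⟨j, rfl⟩ := Fin.exists_succAbove_eq hj
      exact congrFun hrest j
  obtain ⟨R, hR, hdet⟩ := exists_strictMono_det_ne_zero _ hind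
  have h1 := last_mul_det_submatrix_succ (A.submatrix R h) (t.insertNth (α := fun _ => ℝ) 0 α) (by
      ext i; exact hα' (R i))
  have e0 : t.insertNth (α := fun _ => ℝ) 0 α 0 = α 0 := by
    have : t.succAbove 0 = 0 := Fin.succAbove_ne_zero_zero ht0
    conv_lhs => rw [← this]
    exact Fin.insertNth_apply_succAbove _ _ _ _
  have e1 : t.insertNth (α := fun _ => ℝ) 0 α (Fin.last _) = α (Fin.last k) := by
    have : t.succAbove (Fin.last k) = Fin.last _ := Fin.succAbove_ne_last_last ht1
    conv_lhs => rw [← this]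
    exact Fin.insertNth_apply_succAbove _ _ _ _
  rw [e0, e1, pow_succ] at h1
  have p0 : 0 < ((A.submatrix R h).submatrix id Fin.succ).det :=
    lt_of_le_of_ne (hA _ _ _ hR (h.strictMono.comp Fin.strictMono_succ)) (Ne.symm hdet)
  have p1 : 0 ≤ ((A.submatrix R h).submatrix id Fin.castSucc).det :=
    hA _ _ _ hR (h.strictMono.comp Fin.strictMono_castSucc)
  have h3 : 0 < (α (Fin.last k)) ^ 2 * ((A.submatrix R h).submatrix id Fin.succ).det :=
    mul_pos (by positivity) p0
  have h5 : (α (Fin.last k)) ^ 2 * ((A.submatrix R h).submatrix id Fin.succ).det =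
      -((α (Fin.last k) * (α 0 * (-1) ^ k)) *
        ((A.submatrix R h).submatrix id Fin.castSucc).det) := by
    rw [pow_two, mul_assoc, h1]; ring
  have := mul_nonneg hsign.le p1
  linarith

end IsTotallyNonnegative

/-! ### Positive spectrum of Hurwitz arrays -/

open Matrix

/-- The `n × n` Hurwitz array of a sequence of coefficients. -/
def hurwitzOf (a : ℕ → ℝ) (n : ℕ) : Matrix (Fin n) (Fin n) ℝ :=
  Matrix.of fun i j => if (i : ℕ) ≤ 2 * (j : ℕ) + 1 then a (2 * (j : ℕ) + 1 - (i : ℕ)) else 0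

theorem hurwitzOf_apply (a : ℕ → ℝ) {n : ℕ} (i j : Fin n) : hurwitzOf a n i j =
    if (i : ℕ) ≤ 2 * (j : ℕ) + 1 then a (2 * (j : ℕ) + 1 - (i : ℕ)) else 0 := rfl

theorem hurwitzOf_eq_apply (a : ℕ → ℝ) {n : ℕ} {i j : Fin n} {k : ℕ} (h : (i : ℕ) + k = 2 * j + 1) :
    hurwitzOf a n i j = a k := by
  rw [hurwitzOf_apply, if_pos (by omega)]
  congr 1
  omega

namespace IsTotallyNonnegative

variable {n : ℕ}

/-- An eigenvector of a totally nonnegative matrix with positive subdiagonal, for a positive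
eigenvalue, has nonzero last entry. -/
theorem eq_zero_of_mulVec_eq_smul {A : Matrix (Fin (n + 1)) (Fin (n + 1)) ℝ}
    (hA : IsTotallyNonnegative A) (hsub : ∀ i : Fin n, 0 < A i.succ i.castSucc) {x : ℝ}
    (hx : 0 < x) {v : Fin (n + 1) → ℝ} (hv : A *ᵥ v = x • v) (h0 : v (Fin.last n) = 0) : v = 0 := by
  have hdet := (hA.det_sub_scalar_succ_castSucc_pos hsub hx).ne'
  have h1 : (A - diagonal fun _ => x) *ᵥ v = 0 := by
    rw [sub_mulVec, hv, sub_eq_zero]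
    ext i
    simp [mulVec_diagonal]
  have h2 : (A - diagonal fun _ => x).submatrix Fin.succ Fin.castSucc *ᵥ
      (fun i => v i.castSucc) = 0 := by
    ext i
    have := congrFun h1 i.succ
    rw [mulVec, dotProduct, Fin.sum_univ_castSucc, h0, mul_zero, add_zero] at this
    exact this
  have h3 : (fun i : Fin n => v i.castSucc) = 0 := by
    by_contra hne
    exact hdet (exists_mulVec_eq_zero_iff.1 ⟨_, hne, h2⟩)
  ext i
  exact Fin.lastCases h0 (fun i => congrFun h3 i) i

/-- If all coefficients are positive, then all eigenvalues of a totally nonnegative Hurwitz array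
are real, and the positive ones are simple except for the constant coefficient. -/
theorem hurwitzOf_charpoly {a : ℕ → ℝ} (hA : IsTotallyNonnegative (hurwitzOf a (n + 1)))
    (hpos : ∀ k ≤ n + 1, 0 < a k) (hzero : ∀ k, n + 1 < k → a k = 0) :
    (hurwitzOf a (n + 1)).charpoly.Splits ∧
    ∀ x, 0 < x → (hurwitzOf a (n + 1)).charpoly.rootMultiplicity x ≤ 1 ∨
      (x = a (n + 1) ∧ (hurwitzOf a (n + 1)).charpoly.rootMultiplicity x ≤ 2) := by
  set A := hurwitzOf a (n + 1) with hAdef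
  set A' := A.submatrix Fin.castSucc Fin.castSucc with hA'def
  have hA' : IsTotallyNonnegative A' := hA.submatrix Fin.strictMono_castSucc Fin.strictMono_castSucc
  have hcol : ∀ i : Fin n, A i.castSucc (Fin.last n) = 0 := fun i => by
    have := i.2
    rw [hAdef, hurwitzOf_eq_apply a (k := 2 * n + 1 - i)]
    · exact hzero _ (by omega)
    · simp only [Fin.val_castSucc, Fin.val_last]; omega
  have hcorner : A (Fin.last n) (Fin.last n) = a (n + 1) :=
    hurwitzOf_eq_apply a (by simp only [Fin.val_last]; omega)
  -- The last superdiagonal entry of `A` would be `a (n + 2) = 0`. Only after the last index is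
  -- split off is the superdiagonal positive. The factor removed accounts for the possible double
  -- eigenvalue.
  have hfac : A.charpoly = A'.charpoly * (X - C (a (n + 1))) := by
    rw [charpoly, det_succ_column _ (Fin.last n), Fin.sum_univ_castSucc, Finset.sum_eq_zero,
      zero_add]
    · have h1 : A.charmatrix.submatrix (Fin.last n).succAbove (Fin.last n).succAbove =
          A'.charmatrix := by
        rw [Fin.succAbove_last]
        ext1 i j
        by_cases hij : i = j
        · simp [hij, A']
        · simp [charmatrix_apply_ne, hij, A']
      rw [h1, charmatrix_apply_eq, hcorner, (Even.add_self _).neg_one_pow, one_mul, mul_comm]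
      rfl
    · intro i _
      rw [charmatrix_apply_ne _ _ _ (Fin.castSucc_lt_last i).ne, hcol]
      simp
  have hmain : A'.charpoly.Splits ∧ ∀ x, 0 < x → A'.charpoly.rootMultiplicity x ≤ 1 := by
    rcases n with _ | k
    · have : A'.charpoly = 1 := by simp
      rw [this]
      exact ⟨Splits.one, fun x _ => by rw [rootMultiplicity_eq_zero (by simp)]; omega⟩
    · obtain ⟨h1, h2⟩ := hA'.charpoly_splits_and_derivative_mul_pos
        (fun i => by
          have := i.2
          rw [hA'def, submatrix_apply, hAdef, hurwitzOf_eq_apply a (k := i)]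
          · exact hpos _ (by omega)
          · simp only [Fin.val_castSucc, Fin.val_succ]; omega)
        (fun i => by
          have := i.2
          rw [hA'def, submatrix_apply, hAdef, hurwitzOf_eq_apply a (k := i + 3)]
          · exact hpos _ (by omega)
          · simp only [Fin.val_castSucc, Fin.val_succ]; omega)
      refine ⟨h1, fun x hx => ?_⟩
      by_contra hlt
      have h3 := (one_lt_rootMultiplicity_iff_isRoot A'.charpoly_monic.ne_zero).1 (not_le.1 hlt)
      have h4 := h2 x hx h3.1
      rw [h3.2.eq_zero, zero_mul] at h4
      exact lt_irrefl _ h4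
  rw [hfac]
  refine ⟨hmain.1.mul (Splits.X_sub_C _), fun x hx => ?_⟩
  rw [rootMultiplicity_mul (mul_ne_zero A'.charpoly_monic.ne_zero (X_sub_C_ne_zero _)),
    rootMultiplicity_X_sub_C]
  have := hmain.2 x hx
  split_ifs with h
  · exact Or.inr ⟨h, by omega⟩
  · exact Or.inl (by omega)

theorem hurwitzOf_succ_castSucc_pos {a : ℕ → ℝ} (hpos : ∀ k ≤ n + 1, 0 < a k) (i : Fin n) :
    0 < hurwitzOf a (n + 1) i.succ i.castSucc := by
  have := i.2
  rw [hurwitzOf_eq_apply a (k := i)]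
  · exact hpos _ (by omega)
  · simp only [Fin.val_castSucc, Fin.val_succ]; omega

/-- The coefficients of a totally nonnegative Hurwitz array are positive if the first two and the
last are. -/
theorem hurwitzOf_coeff_pos {a : ℕ → ℝ} (hA : IsTotallyNonnegative (hurwitzOf a n))
    (h0 : 0 < a 0) (h1 : 0 < a 1) (hn : a n ≠ 0) : ∀ k ≤ n, 0 < a k := by
  have hnn : ∀ k ≤ n, 0 ≤ a k := fun k hk => by
    rcases Nat.eq_zero_or_pos n with h | h
    · obtain rfl : k = 0 := by omega
      exact h0.le
    · rcases Nat.even_or_odd' k with ⟨j, rfl | rfl⟩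
      · by_cases hj : j = 0
        · subst hj; exact h0.le
        have := hA.apply_nonneg ⟨1, by omega⟩ ⟨j, by omega⟩
        rwa [hurwitzOf_eq_apply a (k := 2 * j) (by simp only; omega)] at this
      · have := hA.apply_nonneg ⟨0, by omega⟩ ⟨j, by omega⟩
        rwa [hurwitzOf_eq_apply a (k := 2 * j + 1) (by simp only; omega)] at this
  -- The 2 × 2 minors give `a_0 a_{2j+1} ≤ a_1 a_{2j}` and `a_1 a_{2j+2} ≤ a_2 a_{2j+1}`, so a zero
  -- would propagate up to `a n`.
  have step : ∀ k, 2 ≤ k → k < n → a k = 0 → a (k + 1) = 0 := by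
    intro k hk hkn hk0
    refine le_antisymm ?_ (hnn _ hkn)
    rcases Nat.even_or_odd' k with ⟨j, rfl | rfl⟩
    · have := hA.mul_le_mul (i := ⟨0, by omega⟩) (i' := ⟨1, by omega⟩) (j := ⟨0, by omega⟩)
        (j' := ⟨j, by omega⟩) (Fin.mk_lt_mk.2 (by omega)) (Fin.mk_lt_mk.2 (by omega))
      rw [hurwitzOf_eq_apply a (k := 2 * j + 1) (by simp only; omega),
        hurwitzOf_eq_apply a (k := 0) (by simp only),
        hurwitzOf_eq_apply a (k := 1) (by simp only),
        hurwitzOf_eq_apply a (k := 2 * j) (by simp only; omega), hk0, mul_zero] at this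
      exact nonpos_of_mul_nonpos_left this h0
    · have := hA.mul_le_mul (i := ⟨1, by omega⟩) (i' := ⟨2, by omega⟩) (j := ⟨1, by omega⟩)
        (j' := ⟨j + 1, by omega⟩) (Fin.mk_lt_mk.2 (by omega)) (Fin.mk_lt_mk.2 (by omega))
      rw [hurwitzOf_eq_apply a (k := 2 * j + 1 + 1) (by simp only; omega),
        hurwitzOf_eq_apply a (k := 1) (by simp only),
        hurwitzOf_eq_apply a (k := 2) (by simp only),
        hurwitzOf_eq_apply a (k := 2 * j + 1) (by simp only; omega), hk0, mul_zero] at this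
      exact nonpos_of_mul_nonpos_left this h1
  intro k hk
  refine lt_of_le_of_ne (hnn k hk) fun h => ?_
  have hk2 : 2 ≤ k := by
    by_contra hlt
    have : k = 0 ∨ k = 1 := by omega
    rcases this with rfl | rfl
    · exact h0.ne h
    · exact h1.ne h
  have hall : ∀ j, k + j ≤ n → a (k + j) = 0 := fun j => by
    induction j with
    | zero => exact fun _ => h.symm
    | succ j ih => exact fun hj => step (k + j) (by omega) (by omega) (ih (by omega))
  exact hn (by simpa [hk] using hall (n - k) (by omega))

/-- The structure of the positive spectrum of a totally nonnegative Hurwitz array. -/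
theorem hurwitzOf_spectrum {a : ℕ → ℝ} (hn0 : 0 < n) (hA : IsTotallyNonnegative (hurwitzOf a n))
    (h0 : 0 < a 0) (hn : a n ≠ 0) (hzero : ∀ k, n < k → a k = 0) :
    (hurwitzOf a n).charpoly.Splits ∧ ∀ x, 0 < x →
      Module.finrank ℝ (Module.End.eigenspace (toLin' (hurwitzOf a n)) x) ≤ 1 ∧
      ((hurwitzOf a n).charpoly.rootMultiplicity x ≤ 1 ∨
        (x = a n ∧ (hurwitzOf a n).charpoly.rootMultiplicity x ≤ 2)) := by
  have hdim : ∀ (i : Fin n) (x : ℝ),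
      (∀ v, hurwitzOf a n *ᵥ v = x • v → v i = 0 → v = 0) →
      Module.finrank ℝ (Module.End.eigenspace (toLin' (hurwitzOf a n)) x) ≤ 1 := by
    intro i x h
    let φ : Module.End.eigenspace (toLin' (hurwitzOf a n)) x →ₗ[ℝ] ℝ :=
      (LinearMap.proj i).comp (Submodule.subtype _)
    have hφ : Function.Injective φ := by
      rw [← LinearMap.ker_eq_bot, LinearMap.ker_eq_bot']
      intro v hv
      have h1 := Module.End.mem_eigenspace_iff.1 v.2
      rw [toLin'_apply] at h1
      exact Subtype.ext (h v.1 h1 hv)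
    have := LinearMap.finrank_le_finrank_of_injective hφ
    rwa [Module.finrank_self] at this
  have hodd : ∀ j (hj : j < n), a (2 * j + 1) = hurwitzOf a n ⟨0, hn0⟩ ⟨j, hj⟩ := fun j hj =>
    (hurwitzOf_eq_apply a (by simp only; omega)).symm
  have h1nn : 0 ≤ a 1 := by
    have := hodd 0 hn0
    rw [this]
    exact hA.apply_nonneg _ _
  rcases h1nn.eq_or_lt with h1 | h1
  -- From `a_0 a_{2j+1} ≤ a_1 a_{2j} = 0`. In zero-based indexing the even rows then vanish, and the
  -- odd rows and columns form the Hurwitz array of `g k = a (2 * k)`.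
  · have hoddz : ∀ j, a (2 * j + 1) = 0 := fun j => by
      by_cases hj0 : j = 0
      · rw [hj0]; exact h1.symm
      by_cases hj : j < n
      · have hle := hA.mul_le_mul (i := ⟨0, by omega⟩) (i' := ⟨1, by omega⟩) (j := ⟨0, by omega⟩)
          (j' := ⟨j, by omega⟩) (Fin.mk_lt_mk.2 (by omega))
          (Fin.mk_lt_mk.2 (by omega))
        have hnn := hA.apply_nonneg ⟨0, hn0⟩ ⟨j, hj⟩
        rw [hurwitzOf_eq_apply a (k := 2 * j + 1) (by simp only; omega),
          hurwitzOf_eq_apply a (k := 0) (by simp only),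
          hurwitzOf_eq_apply a (k := 1) (by simp only), ← h1, zero_mul] at hle
        rw [← hodd j hj] at hnn
        exact le_antisymm (nonpos_of_mul_nonpos_left hle h0) hnn
      · exact hzero _ (by omega)
    obtain ⟨l, rfl⟩ : ∃ l, n = 2 * (l + 1) := by
      rcases Nat.even_or_odd' n with ⟨l, hl | hl⟩
      · exact ⟨l - 1, by omega⟩
      · exact absurd (hl ▸ hoddz l) hn
    set A := hurwitzOf a (2 * (l + 1)) with hAdef
    set g : ℕ → ℝ := fun k => a (2 * k) with hg
    have hodd_lt : ∀ i : Fin (l + 1), 2 * (i : ℕ) + 1 < 2 * (l + 1) := fun i => by omega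
    let o : Fin (l + 1) → Fin (2 * (l + 1)) := fun i => ⟨2 * i + 1, hodd_lt i⟩
    have ho : StrictMono o := fun i j hij => by
      simp only [o, Fin.mk_lt_mk]
      have := Fin.lt_def.1 hij
      omega
    have hB : A.submatrix o o = hurwitzOf g (l + 1) := by
      ext i j
      simp only [submatrix_apply, hAdef, hurwitzOf_apply, o, hg]
      by_cases h : (i : ℕ) ≤ 2 * j + 1
      · rw [if_pos (by omega), if_pos h]
        congr 1
        omega
      · rw [if_neg (by omega), if_neg h]
    have hrow : ∀ (i : Fin (2 * (l + 1))) (j), Even (i : ℕ) → A i j = 0 := fun i j hi => by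
      obtain ⟨k, hk⟩ := hi
      rw [hAdef, hurwitzOf_apply]
      split_ifs with h
      · rw [show 2 * (j : ℕ) + 1 - i = 2 * (j - k) + 1 by omega]
        exact hoddz _
      · rfl
    have hTB : IsTotallyNonnegative (hurwitzOf g (l + 1)) := hB ▸ hA.submatrix ho ho
    have hgpos : ∀ k ≤ l + 1, 0 < g k := by
      have hnn : ∀ k ≤ l + 1, 0 ≤ g k := fun k hk => by
        by_cases hk0 : k = 0
        · subst hk0; exact h0.le
        have := hA.apply_nonneg ⟨1, by omega⟩ ⟨k, by omega⟩
        rwa [hAdef, hurwitzOf_eq_apply a (k := 2 * k) (by simp only; omega)] at this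
      have step : ∀ k, k < l + 1 → g k = 0 → g (k + 1) = 0 := fun k hk hk0 => by
        have hk1 : k ≠ 0 := by
          rintro rfl
          exact h0.ne' hk0
        have hle := hA.mul_le_mul (i := ⟨1, by omega⟩) (i' := ⟨3, by omega⟩)
          (j := ⟨1, by omega⟩) (j' := ⟨k + 1, by omega⟩) (Fin.mk_lt_mk.2 (by omega))
          (Fin.mk_lt_mk.2 (by omega))
        rw [hAdef, hurwitzOf_eq_apply a (k := 2 * (k + 1)) (by simp only; omega),
          hurwitzOf_eq_apply a (k := 0) (by simp only),
          hurwitzOf_eq_apply a (k := 2) (by simp only),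
          hurwitzOf_eq_apply a (k := 2 * k) (by simp only; omega)] at hle
        have hk0' : a (2 * k) = 0 := hk0
        rw [hk0', mul_zero] at hle
        exact le_antisymm (nonpos_of_mul_nonpos_left hle h0) (hnn _ hk)
      intro k hk
      refine lt_of_le_of_ne (hnn k hk) fun h => ?_
      have hall : ∀ j, k + j ≤ l + 1 → g (k + j) = 0 := fun j => by
        induction j with
        | zero => exact fun _ => h.symm
        | succ j ih => exact fun hj => step (k + j) (by omega) (ih (by omega))
      exact hn (by simpa [hk, hg] using hall (l + 1 - k) (by omega))
    obtain ⟨hs, hm⟩ := hTB.hurwitzOf_charpoly hgpos fun k hk => hzero _ (by omega)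
    have hchar : A.charpoly = X ^ (l + 1) * (hurwitzOf g (l + 1)).charpoly := by
      let f : Fin (l + 1) ⊕ Fin (l + 1) → Fin (2 * (l + 1)) :=
        Sum.elim (fun i => ⟨2 * i, by omega⟩) o
      have hf : Function.Bijective f := by
        rw [Fintype.bijective_iff_injective_and_card]
        constructor
        · rintro (i | i) (j | j) hij <;> simp [f, o, Fin.ext_iff] at hij ⊢ <;> omega
        · simp [two_mul]
      let e := Equiv.ofBijective f hf
      have h2 : reindex e.symm e.symm A =
          fromBlocks 0 0 (A.submatrix e e).toBlocks₂₁ (hurwitzOf g (l + 1)) := by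
        rw [← hB, reindex_apply, Equiv.symm_symm]
        ext (i | i) (j | j)
        · exact hrow _ _ (by simp [e, f])
        · exact hrow _ _ (by simp [e, f])
        · rfl
        · rfl
      rw [← charpoly_reindex e.symm A, h2, charpoly_fromBlocks_zero₁₂]
      simp
    refine ⟨hchar ▸ (Splits.X_pow _).mul hs, fun x hx => ⟨?_, ?_⟩⟩
    · refine hdim (o (Fin.last l)) x fun v hv h0 => ?_
      -- A zero row forces the entry to vanish since `x ≠ 0`, so the eigenvector is determined by
      -- its odd part.
      have heven : ∀ i : Fin (2 * (l + 1)), Even (i : ℕ) → v i = 0 := fun i hi => by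
        have := congrFun hv i
        rw [mulVec, dotProduct, Finset.sum_eq_zero fun j _ => by rw [hrow i j hi, zero_mul]] at this
        exact (mul_eq_zero.1 this.symm).resolve_left hx.ne'
      have hvo := hTB.eq_zero_of_mulVec_eq_smul (hurwitzOf_succ_castSucc_pos hgpos) hx
        (v := v ∘ o) (by
          ext i
          have h1 := congrFun hv (o i)
          rw [mulVec, dotProduct, ← hB]
          simp only [submatrix_apply, Function.comp_apply, Pi.smul_apply] at h1 ⊢
          rw [← h1, mulVec, dotProduct, ← Finset.sum_image (s := Finset.univ) (g := o)
            (f := fun j => A (o i) j * v j) (ho.injective.injOn)]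
          refine Finset.sum_subset (Finset.subset_univ _) fun j _ hj => ?_
          rw [heven j, mul_zero]
          by_contra hodd
          rw [Nat.not_even_iff_odd] at hodd
          obtain ⟨t, ht⟩ := hodd
          exact hj (Finset.mem_image.2 ⟨⟨t, by omega⟩, Finset.mem_univ _, Fin.ext ht.symm⟩)) h0
      ext i
      rcases Nat.even_or_odd' (i : ℕ) with ⟨t, ht | ht⟩
      · exact heven i ⟨t, by omega⟩
      · have := congrFun hvo ⟨t, by omega⟩
        rwa [Function.comp_apply, show o ⟨t, by omega⟩ = i from Fin.ext ht.symm] at this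
    · have hx0 : (X ^ (l + 1) : ℝ[X]).rootMultiplicity x = 0 :=
        rootMultiplicity_eq_zero (by simp [hx.ne'])
      rw [hchar, rootMultiplicity_mul (mul_ne_zero (by simp)
        (hurwitzOf g (l + 1)).charpoly_monic.ne_zero), hx0, zero_add]
      exact hm x hx
  · obtain ⟨k, rfl⟩ : ∃ k, n = k + 1 := ⟨n - 1, by omega⟩
    have hpos := hA.hurwitzOf_coeff_pos h0 h1 hn
    obtain ⟨hs, hm⟩ := hA.hurwitzOf_charpoly hpos hzero
    refine ⟨hs, fun x hx => ⟨hdim (Fin.last k) x fun v hv h0 => ?_, hm x hx⟩⟩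
    exact hA.eq_zero_of_mulVec_eq_smul (hurwitzOf_succ_castSucc_pos hpos) hx hv h0

end IsTotallyNonnegative

/-! ### Even factors of a polynomial -/

namespace Polynomial

theorem coeff_comp_neg_X {R : Type*} [CommRing R] (p : R[X]) (k : ℕ) :
    (p.comp (-X)).coeff k = (-1) ^ k * p.coeff k := by
  have : (-X : R[X]) = C (-1) * X := by simp
  rw [this, comp_C_mul_X_coeff, mul_comm]

theorem comp_neg_X_eq_self_iff {p : ℝ[X]} : p.comp (-X) = p ↔ ∀ k, p.coeff (2 * k + 1) = 0 := by
  rw [Polynomial.ext_iff]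
  simp only [coeff_comp_neg_X]
  constructor
  · intro h k
    have := h (2 * k + 1)
    rw [Odd.neg_one_pow ⟨k, rfl⟩] at this
    linarith
  · intro h k
    rcases Nat.even_or_odd' k with ⟨j, rfl | rfl⟩
    · simp
    · rw [h, mul_zero]

/-- If `q` is coprime to `q(-X)` and `g * q` is even, then `deg g - deg q` is a nonnegative even
number. -/
theorem exists_natDegree_eq_of_even_mul {g q : ℝ[X]} (hg : g ≠ 0)
    (hq : IsCoprime q (q.comp (-X))) (h : ∀ k, (g * q).coeff (2 * k + 1) = 0) :
    ∃ k, g.natDegree = q.natDegree + 2 * k := by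
  have he := comp_neg_X_eq_self_iff.2 h
  rw [mul_comp_neg_X] at he
  -- Evenness of `g * q` reads `g * q = g(-X) * q(-X)`. Once `q(-X)` is divided out of `g`, the
  -- quotient `w` is even too.
  have hdvd : q.comp (-X) ∣ g := hq.symm.dvd_of_dvd_mul_right ⟨g.comp (-X), by rw [← he, mul_comm]⟩
  obtain ⟨w, rfl⟩ := hdvd
  have hq0 : q.comp (-X) ≠ 0 := left_ne_zero_of_mul hg
  have hw0 : w ≠ 0 := right_ne_zero_of_mul hg
  have hq0' : q ≠ 0 := fun h0 => hq0 (by simp [h0])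
  rw [mul_comp_neg_X, comp_neg_X_comp_neg_X] at he
  have hw : w.comp (-X) = w := by
    refine mul_left_cancel₀ (mul_ne_zero hq0' hq0) ?_
    linear_combination he
  rw [comp_neg_X_eq_self_iff] at hw
  rcases Nat.even_or_odd' w.natDegree with ⟨k, hk | hk⟩
  · refine ⟨k, ?_⟩
    rw [natDegree_mul hq0 hw0, hk, natDegree_comp]
    simp
  · exact absurd (hk ▸ hw k : w.coeff w.natDegree = 0) (by simpa using hw0)

/-- A real polynomial not vanishing at zero is the product of an even polynomial and a polynomial
coprime to its reflection. -/
theorem exists_eq_mul_expand_two {f : ℝ[X]} (hf : f.coeff 0 ≠ 0) :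
    ∃ q D : ℝ[X], f = q * expand ℝ 2 D ∧ IsCoprime q (q.comp (-X)) := by
  have hf0 : f ≠ 0 := fun h => hf (by simp [h])
  have hf' : f.comp (-X) ≠ 0 := by rwa [Ne, comp_neg_X_eq_zero_iff]
  set G := EuclideanDomain.gcd f (f.comp (-X)) with hG
  have hGf : G ∣ f := EuclideanDomain.gcd_dvd_left _ _
  have hGf' : G ∣ f.comp (-X) := EuclideanDomain.gcd_dvd_right _ _
  have hG0 : G ≠ 0 := fun h => hf0 (zero_dvd_iff.1 (h ▸ hGf))
  -- The gcd divides its reflection and conversely, so they differ by a constant; comparing the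
  -- nonzero values at `0` makes it `1`.
  have hGe : G.comp (-X) = G := by
    obtain ⟨u, hu⟩ : G.comp (-X) ∣ G := EuclideanDomain.dvd_gcd ((dvd_comp_neg_X_iff _ _).1 hGf')
      ((dvd_comp_neg_X_iff _ _).2 (by rwa [comp_neg_X_comp_neg_X]))
    have hu0 : u ≠ 0 := fun h => hG0 (by rw [hu, h, mul_zero])
    have hdeg := congrArg natDegree hu
    rw [natDegree_mul (by rwa [Ne, comp_neg_X_eq_zero_iff]) hu0, natDegree_comp] at hdeg
    simp only [natDegree_neg, natDegree_X, mul_one] at hdeg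
    obtain ⟨c, rfl⟩ := natDegree_eq_zero.1 (show u.natDegree = 0 by omega)
    have h0 := congrArg (fun p => coeff p 0) hu
    simp only [coeff_mul_C, coeff_comp_neg_X, pow_zero, one_mul] at h0
    have hGc : G.coeff 0 ≠ 0 := by
      obtain ⟨v, hv⟩ := hGf
      rw [hv, mul_coeff_zero] at hf
      exact left_ne_zero_of_mul hf
    have hc : c = 1 := by
      have : G.coeff 0 * (c - 1) = 0 := by linarith
      rcases mul_eq_zero.1 this with h | h
      · exact absurd h hGc
      · linarith
    rw [hc, C_1, mul_one] at hu
    exact hu.symm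
  have hGexp : expand ℝ 2 (contract 2 G) = G := by
    rw [comp_neg_X_eq_self_iff] at hGe
    ext k
    rw [coeff_expand two_pos, coeff_contract two_ne_zero]
    split_ifs with h
    · rw [Nat.div_mul_cancel h]
    · obtain ⟨j, rfl⟩ : ∃ j, k = 2 * j + 1 := ⟨k / 2, by omega⟩
      exact (hGe j).symm
  have hbez := EuclideanDomain.gcd_eq_gcd_ab f (f.comp (-X))
  rw [← hG] at hbez
  obtain ⟨q, hq⟩ := hGf
  have hq' : f.comp (-X) = G * q.comp (-X) := by rw [hq, mul_comp_neg_X, hGe]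
  refine ⟨q, contract 2 G, by rw [hGexp, mul_comm, hq], EuclideanDomain.gcdA f (f.comp (-X)),
    EuclideanDomain.gcdB f (f.comp (-X)), mul_left_cancel₀ hG0 ?_⟩
  generalize EuclideanDomain.gcdA f (f.comp (-X)) = a at *
  generalize EuclideanDomain.gcdB f (f.comp (-X)) = b at *
  rw [hq'] at hbez
  clear hG hGe hGexp hf' hGf' hq'
  linear_combination -hbez - a * hq

end Polynomial

/-! ### Factorization of the Hurwitz array -/

/-- The upper triangular Toeplitz matrix of the coefficients of a polynomial. -/
def toeplitzOf (D : ℝ[X]) (n : ℕ) : Matrix (Fin n) (Fin n) ℝ :=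
  Matrix.of fun i j => if i ≤ j then D.coeff ((j : ℕ) - i) else 0

theorem toeplitzOf_apply (D : ℝ[X]) {n : ℕ} (i j : Fin n) :
    toeplitzOf D n i j = if i ≤ j then D.coeff ((j : ℕ) - i) else 0 := rfl

theorem det_toeplitzOf (D : ℝ[X]) (n : ℕ) : (toeplitzOf D n).det = D.coeff 0 ^ n := by
  rw [det_of_isUpperTriangular]
  · simp [toeplitzOf_apply]
  · intro i j hij
    exact if_neg (not_le.2 hij)

/-- Multiplying by `X^(2d)` shifts the Hurwitz array by `d` columns, which is right multiplication
by the Toeplitz matrix of `X^d`; the rest is linearity in `D`. -/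
theorem hurwitzOf_mul_expand (q D : ℝ[X]) (n : ℕ) :
    hurwitzOf (q * expand ℝ 2 D).coeff n = hurwitzOf q.coeff n * toeplitzOf D n := by
  induction D using Polynomial.induction_on' with
  | add D E hD hE =>
    have h1 : toeplitzOf (D + E) n = toeplitzOf D n + toeplitzOf E n := by
      ext i j
      rw [Matrix.add_apply]
      simp only [toeplitzOf_apply]
      split_ifs <;> simp
    have h2 : hurwitzOf (q * expand ℝ 2 (D + E)).coeff n =
        hurwitzOf (q * expand ℝ 2 D).coeff n + hurwitzOf (q * expand ℝ 2 E).coeff n := by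
      ext i j
      rw [Matrix.add_apply]
      simp only [hurwitzOf_apply, map_add, mul_add, coeff_add]
      split_ifs <;> simp
    rw [h1, h2, hD, hE, mul_add]
  | monomial d r =>
    ext i j
    rw [mul_apply, expand_monomial, ← C_mul_X_pow_eq_monomial, hurwitzOf_apply,
      ← mul_assoc, coeff_mul_X_pow', coeff_mul_C]
    by_cases hd : d ≤ j
    · obtain ⟨k, hk⟩ : ∃ k : Fin n, (k : ℕ) + d = j := ⟨⟨j - d, by omega⟩, by simp only; omega⟩
      rw [Finset.sum_eq_single k]
      · rw [toeplitzOf_apply, if_pos (Fin.le_def.2 (by omega)), hurwitzOf_apply,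
          coeff_monomial, if_pos (by omega : d = (j : ℕ) - k)]
        by_cases hi : (i : ℕ) ≤ 2 * k + 1
        · rw [if_pos (by omega), if_pos (by omega), if_pos hi]
          congr 2
          omega
        · rw [if_neg hi, zero_mul]
          split_ifs <;> first | rfl | omega
      · intro k' _ hk'
        rw [toeplitzOf_apply, coeff_monomial]
        split_ifs with h1 h2
        · exact absurd (Fin.ext (by have := Fin.le_def.1 h1; omega)) hk'
        · rw [mul_zero]
        · rw [mul_zero]
      · simp
    · rw [Finset.sum_eq_zero]
      · split_ifs <;> first | rfl | omega
      · intro k _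
        rw [toeplitzOf_apply, coeff_monomial]
        split_ifs with h1 h2
        · exact absurd h2 (by omega)
        · rw [mul_zero]
        · rw [mul_zero]

theorem det_hurwitzOf_mul_expand (q D : ℝ[X]) (n : ℕ) :
    (hurwitzOf (q * expand ℝ 2 D).coeff n).det =
      (hurwitzOf q.coeff n).det * D.coeff 0 ^ n := by
  rw [hurwitzOf_mul_expand, det_mul, det_toeplitzOf]

theorem det_hurwitzOf_eq_zero {q : ℝ[X]} {n : ℕ} (h : q.natDegree < n) :
    (hurwitzOf q.coeff n).det = 0 := by
  refine det_eq_zero_of_column_eq_zero ⟨n - 1, by omega⟩ fun i => ?_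
  have := i.2
  rw [hurwitzOf_eq_apply (k := 2 * (n - 1) + 1 - i) _ (by simp only; omega)]
  exact coeff_eq_zero_of_natDegree_lt (by omega)

/-! ### Independent rows and columns, and the eigenvalue zero -/

/-- The increasing enumeration of the indices `0, …, m - 1, m + 1, m + 3, …, m + 2 * l - 1`. -/
def hurwitzIndex (m l : ℕ) (i : Fin (m + l)) : Fin (m + 2 * l) :=
  ⟨if (i : ℕ) < m then i else m + 1 + 2 * (i - m), by split_ifs <;> omega⟩

theorem hurwitzIndex_val {m l : ℕ} (i : Fin (m + l)) : (hurwitzIndex m l i : ℕ) =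
    if (i : ℕ) < m then (i : ℕ) else m + 1 + 2 * (i - m) := rfl

theorem hurwitzIndex_strictMono (m l : ℕ) : StrictMono (hurwitzIndex m l) := fun i j hij => by
  have := Fin.lt_def.1 hij
  rw [Fin.lt_def, hurwitzIndex_val, hurwitzIndex_val]
  split_ifs <;> omega

theorem hurwitzOf_coeff_eq_zero (q : ℝ[X]) (l : ℕ) (i k : Fin (q.natDegree + 2 * l))
    (hk : q.natDegree + l ≤ k) : hurwitzOf q.coeff _ i k = 0 := by
  have := i.2
  rw [hurwitzOf_eq_apply _ (k := 2 * k + 1 - i) (by omega)]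
  exact coeff_eq_zero_of_natDegree_lt (by omega)

/-- A relation between the rows is a polynomial `g`, with exponents in the range of `hurwitzIndex`,
such that `g * q` is even. Its degree would have to be `deg q + 2k`, and these are exactly the
exponents that `hurwitzIndex` skips. -/
theorem det_hurwitzOf_submatrix_ne_zero {q : ℝ[X]} (hq : IsCoprime q (q.comp (-X))) (l : ℕ) :
    ((hurwitzOf q.coeff (q.natDegree + 2 * l)).submatrix (hurwitzIndex q.natDegree l)
      (Fin.castLE (by omega : q.natDegree + l ≤ q.natDegree + 2 * l))).det ≠ 0 := by
  intro hdet
  obtain ⟨c, hc0, hc⟩ := exists_vecMul_eq_zero_iff.2 hdet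
  let g : ℝ[X] := ∑ i, C (c i) * X ^ (hurwitzIndex q.natDegree l i : ℕ)
  have hcoeff : ∀ i, g.coeff (hurwitzIndex q.natDegree l i) = c i := fun i => by
    simp only [g, finsetSum_coeff, coeff_C_mul, coeff_X_pow, mul_ite, mul_one, mul_zero]
    rw [Finset.sum_eq_single i]
    · simp
    · intro j _ hj
      rw [if_neg]
      intro h
      exact hj ((hurwitzIndex_strictMono _ l).injective (Fin.ext h)).symm
    · simp
  have hcoeff0 : ∀ s, (∀ i, s ≠ (hurwitzIndex q.natDegree l i : ℕ)) → g.coeff s = 0 := fun s hs => by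
    simp only [g, finsetSum_coeff, coeff_C_mul, coeff_X_pow, mul_ite, mul_one, mul_zero]
    exact Finset.sum_eq_zero fun i _ => if_neg (hs i)
  have hg0 : g ≠ 0 := fun h => hc0 (by
    ext i
    rw [← hcoeff i, h]
    simp)
  have hmul : ∀ k, (g * q).coeff (2 * k + 1) = ∑ i, c i *
      (if (hurwitzIndex q.natDegree l i : ℕ) ≤ 2 * k + 1 then
        q.coeff (2 * k + 1 - hurwitzIndex q.natDegree l i) else 0) := fun k => by
    simp only [g, Finset.sum_mul, finsetSum_coeff]
    refine Finset.sum_congr rfl fun i _ => ?_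
    rw [mul_assoc, coeff_C_mul, coeff_X_pow_mul']
  obtain ⟨k, hk⟩ := exists_natDegree_eq_of_even_mul hg0 hq fun k => by
    rw [hmul]
    by_cases hkr : k < q.natDegree + l
    · have := congrFun hc ⟨k, hkr⟩
      rw [vecMul, dotProduct] at this
      exact this
    · refine Finset.sum_eq_zero fun i _ => ?_
      have := (hurwitzIndex q.natDegree l i).2
      rw [if_pos (by omega), coeff_eq_zero_of_natDegree_lt (by omega), mul_zero]
  refine hg0 (leadingCoeff_eq_zero.1 ?_)
  rw [leadingCoeff, hk]
  refine hcoeff0 _ fun i => ?_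
  rw [hurwitzIndex_val]
  split_ifs <;> omega

theorem Fin.sum_univ_eq_sum_castLE {n r : ℕ} (h : r ≤ n) (F : Fin n → ℝ)
    (hF : ∀ k : Fin n, r ≤ (k : ℕ) → F k = 0) : ∑ k, F k = ∑ k : Fin r, F (Fin.castLE h k) := by
  rw [← Finset.sum_image (s := Finset.univ) (g := Fin.castLE h) (f := F)
    ((Fin.castLE_injective h).injOn)]
  refine (Finset.sum_subset (Finset.subset_univ _) fun k _ hk => hF k ?_).symm
  by_contra hlt
  exact hk (Finset.mem_image.2 ⟨⟨k, by omega⟩, Finset.mem_univ _, rfl⟩)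

theorem Matrix.submatrix_id_mulVec_eq {m n k : ℕ} (A : Matrix (Fin m) (Fin n) ℝ) {f : Fin k → Fin n}
    (hf : Function.Injective f) (v : Fin k → ℝ) :
    A.submatrix id f *ᵥ v = A *ᵥ Function.extend f v 0 := by
  ext i
  simp only [mulVec, dotProduct, submatrix_apply, id]
  rw [← Finset.sum_subset (Finset.subset_univ (Finset.univ.image f)), Finset.sum_image hf.injOn]
  · simp [hf.extend_apply]
  · intro j _ hj
    rw [Function.extend_apply' _ _ _ (by simpa using hj)]
    simp

/-- The array of `q` has only `deg q + deg D` nonzero columns, and the selected rows already make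
them independent. Thus the equations in these rows alone imply all of `H w = 0`, as
`hurwitzOf_mulVec_eq_zero` completes. -/
theorem toeplitzOf_mulVec_eq_zero {q D : ℝ[X]} (hq : IsCoprime q (q.comp (-X)))
    {w : Fin (q.natDegree + 2 * D.natDegree) → ℝ}
    (h : ∀ i, (hurwitzOf (q * expand ℝ 2 D).coeff (q.natDegree + 2 * D.natDegree) *ᵥ w) (hurwitzIndex q.natDegree D.natDegree i) = 0) (k : Fin (q.natDegree + 2 * D.natDegree))
    (hk : (k : ℕ) < q.natDegree + D.natDegree) : (toeplitzOf D (q.natDegree + 2 * D.natDegree) *ᵥ w) k = 0 := by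
  have hle : q.natDegree + D.natDegree ≤ q.natDegree + 2 * D.natDegree := by omega
  have h1 : (hurwitzOf q.coeff (q.natDegree + 2 * D.natDegree)).submatrix (hurwitzIndex q.natDegree D.natDegree)
      (Fin.castLE hle) *ᵥ (fun k => (toeplitzOf D (q.natDegree + 2 * D.natDegree) *ᵥ w) (Fin.castLE hle k)) = 0 := by
    ext i
    rw [Pi.zero_apply, ← h i, hurwitzOf_mul_expand, ← mulVec_mulVec]
    conv_rhs => rw [mulVec, dotProduct]
    rw [Fin.sum_univ_eq_sum_castLE hle _ fun k hk => by
      rw [hurwitzOf_coeff_eq_zero q _ _ k hk, zero_mul]]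
    rfl
  by_contra hne
  exact det_hurwitzOf_submatrix_ne_zero hq D.natDegree (exists_mulVec_eq_zero_iff.1
    ⟨_, fun h0 => hne (congrFun h0 ⟨k, hk⟩), h1⟩)

theorem hurwitzOf_mulVec_eq_zero {q D : ℝ[X]} {w : Fin (q.natDegree + 2 * D.natDegree) → ℝ}
    (h : ∀ k : Fin (q.natDegree + 2 * D.natDegree), (k : ℕ) < q.natDegree + D.natDegree → (toeplitzOf D (q.natDegree + 2 * D.natDegree) *ᵥ w) k = 0) :
    hurwitzOf (q * expand ℝ 2 D).coeff (q.natDegree + 2 * D.natDegree) *ᵥ w = 0 := by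
  ext i
  rw [hurwitzOf_mul_expand, ← mulVec_mulVec, mulVec, dotProduct, Pi.zero_apply]
  refine Finset.sum_eq_zero fun k _ => ?_
  by_cases hk : (k : ℕ) < q.natDegree + D.natDegree
  · rw [h k hk, mul_zero]
  · rw [hurwitzOf_coeff_eq_zero q _ i k (not_lt.1 hk), zero_mul]

/-- As the matrix is upper triangular and `w` vanishes from `r` on, the remaining equations hold by
themselves, and the determinant `D(0)^n` is nonzero. -/
theorem eq_zero_of_toeplitzOf_mulVec_of_lt {D : ℝ[X]} (hD0 : D.coeff 0 ≠ 0) {n r : ℕ}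
    {w : Fin n → ℝ} (h : ∀ k : Fin n, (k : ℕ) < r → (toeplitzOf D n *ᵥ w) k = 0)
    (hw : ∀ j : Fin n, r ≤ (j : ℕ) → w j = 0) : w = 0 := by
  by_contra hne
  refine pow_ne_zero n hD0 ((det_toeplitzOf D n).symm.trans
    (exists_mulVec_eq_zero_iff.1 ⟨w, hne, ?_⟩))
  ext k
  by_cases hk : (k : ℕ) < r
  · exact h k hk
  · rw [mulVec, dotProduct, Pi.zero_apply]
    refine Finset.sum_eq_zero fun j _ => ?_
    by_cases hj : k ≤ j
    · rw [hw j ((not_lt.1 hk).trans hj), mul_zero]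
    · rw [toeplitzOf_apply, if_neg hj, zero_mul]

/-- Read forwards, the equations are a linear recurrence of order `deg D` with the leading
coefficient of `D` in front of the newest term; the initial values are zero. -/
theorem eq_zero_of_toeplitzOf_mulVec_of_ge {D : ℝ[X]} (hD : D ≠ 0) {n r : ℕ}
    (hn : n = r + D.natDegree) {w : Fin n → ℝ}
    (h : ∀ k : Fin n, (k : ℕ) < r → (toeplitzOf D n *ᵥ w) k = 0)
    (hw : ∀ j : Fin n, (j : ℕ) < D.natDegree → w j = 0) : w = 0 := by
  suffices H : ∀ (N : ℕ) (j : Fin n), (j : ℕ) = N → w j = 0 from funext fun j => H j j rfl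
  intro N
  induction N using Nat.strong_induction_on with
  | _ N ih =>
    rintro j rfl
    by_cases hj : (j : ℕ) < D.natDegree
    · exact hw j hj
    · have hk := h ⟨j - D.natDegree, by omega⟩ (by simp only; omega)
      rw [mulVec, dotProduct, Finset.sum_eq_single j] at hk
      · rw [toeplitzOf_apply, if_pos (Fin.mk_le_of_le_val (Nat.sub_le _ _))] at hk
        simp only [Nat.sub_sub_self (not_lt.1 hj)] at hk
        exact (mul_eq_zero.1 hk).resolve_left (by simpa using hD)
      · intro i _ hij
        rcases lt_or_gt_of_ne hij with hlt | hlt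
        · rw [ih i (Fin.lt_def.1 hlt) i rfl, mul_zero]
        · have := Fin.lt_def.1 hlt
          rw [toeplitzOf_apply, coeff_eq_zero_of_natDegree_lt (by simp only; omega)]
          simp
      · simp

theorem hurwitzOf_block_independent {q D : ℝ[X]} (hq : IsCoprime q (q.comp (-X)))
    (hD0 : D.coeff 0 ≠ 0) {k x : ℕ} (hx : x + k ≤ q.natDegree + 2 * D.natDegree)
    (h : x + k ≤ q.natDegree + D.natDegree ∨ D.natDegree ≤ x) {v : Fin k → ℝ}
    (hv : (hurwitzOf (q * expand ℝ 2 D).coeff (q.natDegree + 2 * D.natDegree)).submatrix id (fun i : Fin k => (⟨x + i, by omega⟩ : Fin (q.natDegree + 2 * D.natDegree))) *ᵥ v = 0) :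
    v = 0 := by
  have hinj : Function.Injective
      (fun i : Fin k => (⟨x + i, by omega⟩ : Fin (q.natDegree + 2 * D.natDegree))) := fun i j hij => by
    have := congrArg Fin.val hij
    exact Fin.ext (by simp only at this; omega)
  rw [submatrix_id_mulVec_eq _ hinj] at hv
  have hT := toeplitzOf_mulVec_eq_zero hq fun i => congrFun hv (hurwitzIndex q.natDegree D.natDegree i)
  have hD : D ≠ 0 := fun h => hD0 (by simp [h])
  have hw : Function.extend (fun i : Fin k => (⟨x + i, by omega⟩ : Fin (q.natDegree + 2 * D.natDegree)))
      v 0 = 0 := by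
    rcases h with h | h
    · refine eq_zero_of_toeplitzOf_mulVec_of_lt hD0 hT fun j hj =>
        Function.extend_apply' _ _ _ ?_
      rintro ⟨i, rfl⟩
      simp only at hj
      omega
    · refine eq_zero_of_toeplitzOf_mulVec_of_ge hD (by omega) hT fun j hj =>
        Function.extend_apply' _ _ _ ?_
      rintro ⟨i, rfl⟩
      simp only at hj
      omega
  ext i
  rw [← hinj.extend_apply v 0 i, hw]
  rfl

/-- The columns of a totally nonnegative Hurwitz array with the indices `hurwitzIndex` are linearly
independent. -/
theorem IsTotallyNonnegative.hurwitzOf_run_independent {q D : ℝ[X]}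
    (hA : IsTotallyNonnegative (hurwitzOf (q * expand ℝ 2 D).coeff (q.natDegree + 2 * D.natDegree)))
    (hq : IsCoprime q (q.comp (-X))) (hD0 : D.coeff 0 ≠ 0) :
    ∀ (k s : ℕ) (h : s + k ≤ q.natDegree + D.natDegree) (v : Fin k → ℝ),
      (hurwitzOf (q * expand ℝ 2 D).coeff (q.natDegree + 2 * D.natDegree)).submatrix id (fun i : Fin k => hurwitzIndex q.natDegree D.natDegree ⟨s + i, by omega⟩) *ᵥ v = 0 →
      v = 0
  | 0, _, _, v, _ => Subsingleton.elim _ _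
  | k + 1, s, h, α, h0 => by
    by_contra hα
    let f : Fin (k + 1) → Fin (q.natDegree + 2 * D.natDegree) :=
      fun i => hurwitzIndex q.natDegree D.natDegree ⟨s + i, by omega⟩
    have hf : StrictMono f := fun i j hij => hurwitzIndex_strictMono _ _
      (Fin.mk_lt_mk.2 (Nat.add_lt_add_left (Fin.lt_def.1 hij) s))
    have hfs : f ∘ Fin.succ = fun i : Fin k => hurwitzIndex q.natDegree D.natDegree ⟨s + 1 + i, by omega⟩ := by
      funext i
      simp only [f, Function.comp_apply]
      congr 2
      rw [Fin.val_succ]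
      omega
    have hsucc : ∀ v, (hurwitzOf (q * expand ℝ 2 D).coeff (q.natDegree + 2 * D.natDegree)).submatrix id (f ∘ Fin.succ) *ᵥ v = 0 → v = 0 := fun v hv => by
      rw [hfs] at hv
      exact hurwitzOf_run_independent hA hq hD0 k (s + 1) (by omega) v hv
    have hcast : ∀ v, (hurwitzOf (q * expand ℝ 2 D).coeff (q.natDegree + 2 * D.natDegree)).submatrix id (f ∘ Fin.castSucc) *ᵥ v = 0 → v = 0 := fun v hv =>
      hurwitzOf_run_independent hA hq hD0 k s (by omega) v hv
    have hf0 : (f 0 : ℕ) = if s < q.natDegree then s else q.natDegree + 1 + 2 * (s - q.natDegree) := rfl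
    have hfk : (f (Fin.last k) : ℕ) =
      if s + k < q.natDegree then s + k else q.natDegree + 1 + 2 * (s + k - q.natDegree) := rfl
    have hfn := (f (Fin.last k)).2
    -- A block of `k + 1` consecutive columns between `f 0` and `f (Fin.last k)`, placed at the left
    -- end if it fits into the first `deg q + deg D` columns and at the right end otherwise. Such a
    -- block is independent, yet a minimal relation would put it in the span of `k` columns.
    obtain ⟨x, hx0, hxk, hx⟩ : ∃ x, (f 0 : ℕ) ≤ x ∧ x + k ≤ f (Fin.last k) ∧
        (x + (k + 1) ≤ q.natDegree + D.natDegree ∨ D.natDegree ≤ x) := by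
      by_cases hc : (f 0 : ℕ) + (k + 1) ≤ q.natDegree + D.natDegree
      · refine ⟨f 0, le_rfl, ?_, Or.inl hc⟩
        split_ifs at hf0 hfk <;> omega
      · refine ⟨f (Fin.last k) - k, ?_, ?_, Or.inr ?_⟩ <;> split_ifs at hf0 hfk <;> omega
    let b : Fin (k + 1) → Fin (q.natDegree + 2 * D.natDegree) := fun i => ⟨x + i, by omega⟩
    have hspan : ∀ i, ∃ v, (hurwitzOf (q * expand ℝ 2 D).coeff (q.natDegree + 2 * D.natDegree)).submatrix id (f ∘ Fin.succ) *ᵥ v = fun r => hurwitzOf (q * expand ℝ 2 D).coeff (q.natDegree + 2 * D.natDegree) r (b i) := fun i =>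
      hA.exists_mulVec_eq_col hf hα h0 hsucc hcast
        (Fin.le_def.2 (hx0.trans (Nat.le_add_right _ _)))
        (Fin.le_def.2 ((Nat.add_le_add_left (Nat.lt_succ_iff.1 i.2) x).trans hxk))
    choose V hV using hspan
    let W : Matrix (Fin k) (Fin (k + 1)) ℝ := of fun a i => V i a
    obtain ⟨u, hu, hu0⟩ : ∃ u, W *ᵥ u = 0 ∧ u ≠ 0 := by
      have := LinearMap.ker_ne_bot_of_finrank_lt (f := W.mulVecLin) (by simp)
      obtain ⟨u, hu, hu0⟩ := (Submodule.ne_bot_iff _).1 this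
      exact ⟨u, hu, hu0⟩
    have hb : (hurwitzOf (q * expand ℝ 2 D).coeff (q.natDegree + 2 * D.natDegree)).submatrix id b = (hurwitzOf (q * expand ℝ 2 D).coeff (q.natDegree + 2 * D.natDegree)).submatrix id (f ∘ Fin.succ) * W := by
      ext i j
      exact (congrFun (hV j) i).symm
    refine hu0 (hurwitzOf_block_independent hq hD0 (x := x) (by omega) hx ?_)
    change (hurwitzOf (q * expand ℝ 2 D).coeff (q.natDegree + 2 * D.natDegree)).submatrix id b *ᵥ u = 0
    rw [hb, ← mulVec_mulVec, hu, mulVec_zero]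

/-- A kernel vector of the principal submatrix, extended by zero, satisfies the selected equations
and hence lies in the kernel of the full array, contradicting independence of the selected columns.
-/
theorem IsTotallyNonnegative.det_hurwitzOf_submatrix_ne_zero {q D : ℝ[X]}
    (hA : IsTotallyNonnegative (hurwitzOf (q * expand ℝ 2 D).coeff (q.natDegree + 2 * D.natDegree)))
    (hq : IsCoprime q (q.comp (-X))) (hD0 : D.coeff 0 ≠ 0) :
    ((hurwitzOf (q * expand ℝ 2 D).coeff (q.natDegree + 2 * D.natDegree)).submatrix (hurwitzIndex q.natDegree D.natDegree) (hurwitzIndex q.natDegree D.natDegree)).det ≠ 0 := by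
  intro hdet
  obtain ⟨v, hv0, hv⟩ := exists_mulVec_eq_zero_iff.2 hdet
  have hinj := (hurwitzIndex_strictMono q.natDegree D.natDegree).injective
  have hid := submatrix_id_mulVec_eq (hurwitzOf (q * expand ℝ 2 D).coeff (q.natDegree + 2 * D.natDegree)) hinj v
  have hT := toeplitzOf_mulVec_eq_zero (D := D) hq
    (w := Function.extend (hurwitzIndex q.natDegree D.natDegree) v 0) fun i => by
      rw [← hid]
      exact congrFun hv i
  refine hv0 (hA.hurwitzOf_run_independent hq hD0 (q.natDegree + D.natDegree) 0 (by omega) v ?_)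
  have hfun : (fun i : Fin (q.natDegree + D.natDegree) => hurwitzIndex q.natDegree D.natDegree ⟨0 + i, by omega⟩) =
      hurwitzIndex q.natDegree D.natDegree := by
    funext i
    congr 2
    omega
  rw [hfun, hid]
  exact hurwitzOf_mulVec_eq_zero hT

/-- The kernel is cut out by the first `deg q + deg D` rows of the invertible Toeplitz matrix, which
are independent conditions. -/
theorem finrank_eigenspace_zero_hurwitzOf {q D : ℝ[X]} (hq : IsCoprime q (q.comp (-X)))
    (hD0 : D.coeff 0 ≠ 0) :
    Module.finrank ℝ (Module.End.eigenspace (toLin' (hurwitzOf (q * expand ℝ 2 D).coeff (q.natDegree + 2 * D.natDegree))) 0) = D.natDegree := by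
  have hle : q.natDegree + D.natDegree ≤ q.natDegree + 2 * D.natDegree := by omega
  let B : Matrix (Fin (q.natDegree + D.natDegree)) (Fin (q.natDegree + 2 * D.natDegree)) ℝ :=
    (toeplitzOf D _).submatrix (Fin.castLE hle) id
  have hker : Module.End.eigenspace (toLin' (hurwitzOf (q * expand ℝ 2 D).coeff (q.natDegree + 2 * D.natDegree))) 0 = LinearMap.ker B.mulVecLin := by
    ext w
    rw [Module.End.mem_eigenspace_iff, toLin'_apply, zero_smul, LinearMap.mem_ker, mulVecLin_apply]
    constructor
    · intro hw
      ext k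
      exact toeplitzOf_mulVec_eq_zero hq (fun i => congrFun hw _) (Fin.castLE hle k) k.2
    · intro hw
      exact hurwitzOf_mulVec_eq_zero fun k hk => congrFun hw ⟨k, hk⟩
  have hsurj : LinearMap.range B.mulVecLin = ⊤ := by
    rw [LinearMap.range_eq_top]
    intro u
    have hunit : IsUnit (toeplitzOf D (q.natDegree + 2 * D.natDegree)) := by
      rw [isUnit_iff_isUnit_det, det_toeplitzOf]
      exact (pow_ne_zero _ hD0).isUnit
    obtain ⟨w, hw⟩ := mulVec_surjective_iff_isUnit.2 hunit
      (Function.extend (Fin.castLE hle) u 0)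
    refine ⟨w, ?_⟩
    ext k
    rw [← (Fin.castLE_injective hle).extend_apply u 0 k, ← hw]
    rfl
  have := LinearMap.finrank_range_add_finrank_ker B.mulVecLin
  rw [hsurj, finrank_top, Module.finrank_fin_fun, Module.finrank_fin_fun] at this
  rw [hker]
  omega

/-- The nonzero principal minor of order `deg q + deg D` bounds the multiplicity above; the
dimension of the kernel bounds it below. -/
theorem IsTotallyNonnegative.rootMultiplicity_zero_charpoly_hurwitzOf {q D : ℝ[X]}
    (hA : IsTotallyNonnegative (hurwitzOf (q * expand ℝ 2 D).coeff (q.natDegree + 2 * D.natDegree)))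
    (hq : IsCoprime q (q.comp (-X))) (hD0 : D.coeff 0 ≠ 0) :
    (hurwitzOf (q * expand ℝ 2 D).coeff (q.natDegree + 2 * D.natDegree)).charpoly.rootMultiplicity 0 = D.natDegree := by
  refine le_antisymm ?_ ?_
  · rw [rootMultiplicity_eq_natTrailingDegree']
    have hinj := (hurwitzIndex_strictMono q.natDegree D.natDegree).injective
    have hc : (hurwitzOf (q * expand ℝ 2 D).coeff (q.natDegree + 2 * D.natDegree)).charpoly.coeff (q.natDegree + 2 * D.natDegree - (q.natDegree + D.natDegree)) ≠ 0 := by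
      rw [hA.charpoly_coeff_ne_zero_iff (by omega)]
      refine ⟨Finset.univ.map ⟨_, hinj⟩, by simp, ?_⟩
      let e : Fin (q.natDegree + D.natDegree) ≃
          (Finset.univ.map ⟨hurwitzIndex q.natDegree D.natDegree, hinj⟩ : Finset (Fin _)) :=
        Equiv.ofBijective (fun i => ⟨hurwitzIndex q.natDegree D.natDegree i, by simp⟩)
          ⟨fun i j hij => hinj (by simpa using hij), fun ⟨j, hj⟩ => by simpa using hj⟩
      rw [← det_submatrix_equiv_self e]
      exact hA.det_hurwitzOf_submatrix_ne_zero hq hD0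
    exact (natTrailingDegree_le_of_ne_zero hc).trans (by omega)
  · have h := LinearMap.finrank_eigenspace_le (toLin' (hurwitzOf (q * expand ℝ 2 D).coeff (q.natDegree + 2 * D.natDegree))) 0
    rwa [finrank_eigenspace_zero_hurwitzOf hq hD0, charpoly_toLin'] at h

/-! ### Return to the polynomial `p` and conclusion -/

theorem descCoeff_eq_coeff_reverse (p : ℝ[X]) : descCoeff p = p.reverse.coeff := by
  funext k
  rw [descCoeff, coeff_reverse]
  split_ifs with h
  · rw [revAt_le h]
  · rw [revAt_eq_self_of_lt (not_le.1 h), coeff_eq_zero_of_natDegree_lt (not_le.1 h)]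

theorem hurwitzArray_eq (p : ℝ[X]) (k : ℕ) : hurwitzArray p k = hurwitzOf p.reverse.coeff k := by
  rw [← descCoeff_eq_coeff_reverse]
  rfl

theorem finiteHurwitzMatrix_eq (p : ℝ[X]) :
    finiteHurwitzMatrix p = hurwitzOf p.reverse.coeff p.natDegree := hurwitzArray_eq p _

/-- The order of the last nonvanishing Hurwitz determinant. -/
theorem IsTotallyNonnegative.eq_natDegree_of_det_hurwitzOf {q D : ℝ[X]} {m : ℕ}
    (hA : IsTotallyNonnegative
      (hurwitzOf (q * expand ℝ 2 D).coeff (q.natDegree + 2 * D.natDegree)))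
    (hq : IsCoprime q (q.comp (-X))) (hD0 : D.coeff 0 ≠ 0)
    (hm : (hurwitzOf (q * expand ℝ 2 D).coeff m).det ≠ 0)
    (hm1 : (hurwitzOf (q * expand ℝ 2 D).coeff (m + 1)).det = 0) : m = q.natDegree := by
  have hsub : ∀ (k N : ℕ) (h : k ≤ N),
      (hurwitzOf (q * expand ℝ 2 D).coeff N).submatrix (Fin.castLE h) (Fin.castLE h) =
        hurwitzOf (q * expand ℝ 2 D).coeff k := fun k N h => rfl
  apply le_antisymm
  · by_contra hlt
    rw [det_hurwitzOf_mul_expand, det_hurwitzOf_eq_zero (not_le.1 hlt), zero_mul] at hm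
    exact hm rfl
  · by_contra hlt
    have hqd : (hurwitzOf (q * expand ℝ 2 D).coeff q.natDegree).det ≠ 0 := by
      rw [det_hurwitzOf_mul_expand]
      refine mul_ne_zero ?_ (pow_ne_zero _ hD0)
      -- With no extra rows `hurwitzIndex` skips nothing, and the minor is the full Hurwitz
      -- determinant of `q`.
      have h := _root_.det_hurwitzOf_submatrix_ne_zero hq 0
      have h2 : (hurwitzOf q.coeff (q.natDegree + 2 * 0)).submatrix (hurwitzIndex q.natDegree 0)
          (Fin.castLE (by omega)) = hurwitzOf q.coeff (q.natDegree + 0) := by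
        ext i j
        have hi : (i : ℕ) < q.natDegree := i.2
        simp only [submatrix_apply, hurwitzOf_apply, hurwitzIndex_val, Fin.val_castLE, if_pos hi]
      rw [h2] at h
      exact h
    have hle : q.natDegree ≤ q.natDegree + 2 * D.natDegree := Nat.le_add_right _ _
    have hAq : IsTotallyNonnegative (hurwitzOf (q * expand ℝ 2 D).coeff q.natDegree) := by
      rw [← hsub _ _ hle]
      exact hA.submatrix (Fin.strictMono_castLE hle) (Fin.strictMono_castLE hle)
    have := hAq.det_castLE_ne_zero (by omega : m + 1 ≤ q.natDegree) hqd
    rw [hsub] at this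
    exact this hm1

theorem theorem6p1 (p : ℝ[X]) (n m : ℕ) (hn : p.natDegree = n)
    (hlead : 0 < p.leadingCoeff) (hconst : p.eval 0 ≠ 0)
    (hTN : IsTotallyNonnegative (finiteHurwitzMatrix p))
    (hmn : m ≤ n) (hm : hurwitzDet p m ≠ 0) (hm1 : hurwitzDet p (m + 1) = 0) :
    Even (n - m) ∧
    -- the number of positive eigenvalues, counted with algebraic multiplicity
    (finiteHurwitzMatrix p).charpoly.roots.countP (fun x => 0 < x) = (n + m) / 2 ∧
    -- the algebraic and the geometric multiplicity of the eigenvalue zero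
    (finiteHurwitzMatrix p).charpoly.rootMultiplicity 0 = (n - m) / 2 ∧
    Module.finrank ℝ (Module.End.eigenspace (Matrix.toLin' (finiteHurwitzMatrix p)) 0)
      = (n - m) / 2 ∧
    -- the eigenspaces and the algebraic multiplicities of the positive eigenvalues
    (∀ x : ℝ, 0 < x → Module.End.HasEigenvalue (Matrix.toLin' (finiteHurwitzMatrix p)) x →
      Module.finrank ℝ (Module.End.eigenspace (Matrix.toLin' (finiteHurwitzMatrix p)) x) = 1 ∧
      ((finiteHurwitzMatrix p).charpoly.rootMultiplicity x = 1 ∨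
        (x = p.eval 0 ∧ (finiteHurwitzMatrix p).charpoly.rootMultiplicity x = 2))) := by
  have h0 : p.reverse.coeff 0 = p.leadingCoeff := coeff_zero_reverse p
  have hnc : p.reverse.coeff p.natDegree = p.eval 0 := by
    rw [coeff_reverse, revAt_le le_rfl, Nat.sub_self, coeff_zero_eq_eval_zero]
  have hzero : ∀ k, p.natDegree < k → p.reverse.coeff k = 0 := fun k hk =>
    coeff_eq_zero_of_natDegree_lt ((reverse_natDegree_le p).trans_lt hk)
  have hdeg : p.reverse.natDegree = p.natDegree :=
    le_antisymm (reverse_natDegree_le p) (le_natDegree_of_ne_zero (hnc ▸ hconst))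
  obtain ⟨q, D, hf, hq⟩ := exists_eq_mul_expand_two (f := p.reverse) (by rw [h0]; exact hlead.ne')
  have hf0 : p.reverse ≠ 0 := fun h => hlead.ne' (by rw [← h0, h, coeff_zero])
  have hD0 : D.coeff 0 ≠ 0 := by
    have : q.coeff 0 * (expand ℝ 2 D).coeff 0 ≠ 0 := by
      rw [← mul_coeff_zero, ← hf, h0]; exact hlead.ne'
    have := right_ne_zero_of_mul this
    rwa [coeff_expand two_pos, if_pos (dvd_zero 2), Nat.zero_div] at this
  have hdegs : p.natDegree = q.natDegree + 2 * D.natDegree := by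
    rw [← hdeg, hf, natDegree_mul (left_ne_zero_of_mul (hf ▸ hf0))
      (right_ne_zero_of_mul (hf ▸ hf0)), natDegree_expand, mul_comm]
  rw [hurwitzDet, hurwitzArray_eq, hf] at hm hm1
  have hall : ∀ N, N = q.natDegree + 2 * D.natDegree →
      IsTotallyNonnegative (hurwitzOf p.reverse.coeff N) →
      m = q.natDegree ∧
      (hurwitzOf p.reverse.coeff N).charpoly.rootMultiplicity 0 = D.natDegree ∧
      Module.finrank ℝ (Module.End.eigenspace (toLin' (hurwitzOf p.reverse.coeff N)) 0) =
        D.natDegree := by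
    rintro N rfl hA
    rw [hf] at hA ⊢
    exact ⟨hA.eq_natDegree_of_det_hurwitzOf hq hD0 hm hm1,
      hA.rootMultiplicity_zero_charpoly_hurwitzOf hq hD0, finrank_eigenspace_zero_hurwitzOf hq hD0⟩
  rw [finiteHurwitzMatrix_eq] at hTN ⊢
  rw [← hnc]
  obtain ⟨hmq, halg, hgeo⟩ := hall _ hdegs hTN
  have hspec : (hurwitzOf p.reverse.coeff p.natDegree).charpoly.Splits ∧ ∀ x, 0 < x →
      Module.End.HasEigenvalue (toLin' (hurwitzOf p.reverse.coeff p.natDegree)) x →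
      Module.finrank ℝ
        (Module.End.eigenspace (toLin' (hurwitzOf p.reverse.coeff p.natDegree)) x) ≤ 1 ∧
      ((hurwitzOf p.reverse.coeff p.natDegree).charpoly.rootMultiplicity x ≤ 1 ∨
        (x = p.reverse.coeff p.natDegree ∧
          (hurwitzOf p.reverse.coeff p.natDegree).charpoly.rootMultiplicity x ≤ 2)) := by
    rcases Nat.eq_zero_or_pos p.natDegree with hz | hz
    · constructor
      · exact Splits.of_natDegree_eq_zero (by simp [hz])
      · intro x _ hx
        have : IsEmpty (Fin p.natDegree) := by rw [hz]; infer_instance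
        obtain ⟨v, hv⟩ := hx.exists_hasEigenvector
        exact absurd (Subsingleton.elim v 0) hv.2
    · obtain ⟨hs, hx⟩ := hTN.hurwitzOf_spectrum hz (h0 ▸ hlead) (hnc ▸ hconst) hzero
      exact ⟨hs, fun x hx0 _ => hx x hx0⟩
  set A := hurwitzOf p.reverse.coeff p.natDegree with hA
  have hl : (n - m) / 2 = D.natDegree := by omega
  refine ⟨⟨D.natDegree, by omega⟩, ?_, by rw [halg, hl], by rw [hgeo, hl], fun x hx hev => ?_⟩
  · have hcard : A.charpoly.roots.card = n := by
      rw [splits_iff_card_roots.1 hspec.1]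
      simp [hn]
    -- No root is negative, so the roots that are not positive are zeros, and the positive ones are
    -- counted by subtraction from `n`.
    have hcount : A.charpoly.roots.countP (fun x => ¬ 0 < x) = D.natDegree := by
      rw [← halg, ← count_roots, Multiset.count]
      refine Multiset.countP_congr rfl fun x hx => ?_
      have := hTN.nonneg_of_eval_charpoly_eq_zero (mem_roots'.1 hx).2
      rw [not_lt]
      exact propext (by rw [eq_comm (a := (0 : ℝ)), le_antisymm_iff, and_iff_left this])
    have := Multiset.card_eq_countP_add_countP (fun x : ℝ => 0 < x) A.charpoly.roots
    omega
  · obtain ⟨hfin, hmult⟩ := hspec.2 x hx hev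
    have hpos : 0 < Module.finrank ℝ (Module.End.eigenspace (toLin' A) x) := by
      rw [Module.finrank_pos_iff, Submodule.nontrivial_iff_ne_bot]
      exact hev
    have hle := LinearMap.finrank_eigenspace_le (toLin' A) x
    rw [charpoly_toLin'] at hle
    refine ⟨by omega, ?_⟩
    rcases hmult with h | ⟨h, h2⟩
    · exact Or.inl (by omega)
    · by_cases h1 : A.charpoly.rootMultiplicity x = 1
      · exact Or.inl h1
      · exact Or.inr ⟨h, by omega⟩
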